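/- Let $\mathcal X$ be a separable metric space with its Borel $\sigma$-algebra, and let $Y=(Y_n)_{n\ge 0}$ be a time-homogeneous Markov chain on $\mathcal X$ with probability transition kernel $P$; write $\mathbb P_x$ and $\mathbb E_x$ for probability and expectation when $Y_0=x$. Assume that: - $Y$ is topologically irreducible: $\mathbb P_x(\exists n\ge 1: Y_n\in G)>0$ for every $x\in\mathcal X$ and every non-empty open $G\subset\mathcal X$; - $Y$ is topologically recurrent: $\mathbb P_x(\exists n\ge 1: Y_n\in G)=1$ for every non-empty open $G\subset\mathcal X$ and every $x\in G$; - $Y$ is weak Feller: $x\mapsto \mathbb E_x f(Y_1)$ is continuous for every bounded continuous $f:\mathcal X\to\mathbb R$. Let $A\subset\mathcal X$ be a Borel set such that $\mathbb P_x(Y_1\in \operatorname{Int}(A))>0$ for some $x\in\operatorname{Int}(A^c)$. Let $T=\inf\{k\ge 1: Y_{k-1}\in A^c,\ Y_k\in A\}$ (with $\inf\varnothing=\infty$) be the first entrance time into $A$ from $A^c$. The entrance chain $Y^{\rangle A}$ and the exit chain $Y^{A^c\rangle}$ have, on $A$ and on $A^c$ respectively, the transition kernels $$P_A^{entr}(x,B)=\mathbb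 P_x(T<\infty,\ Y_T\in B),\qquad x\in A,\ B\subset A,$$ $$P_{A^c}^{exit}(x,B)=\int_A \mathbb P_z(T<\infty,\ Y_{T-1}\in B)\,\mathbb P_x(Y_1\in dz\mid Y_1\in A),\qquad x\in A^c,\ B\subset A^c,$$ for Borel $B$, where $P_{A^c}^{exit}(x,\cdot)=0$ if $\mathbb P_x(Y_1\in A)=0$; any missing mass is sent to an additional absorbing cemetery state. A Borel measure $\nu$ on $S\in\{\mathcal X,A,A^c\}$ (possibly zero) is called invariant for the corresponding chain with kernel $K$ if $\int_S K(x,B)\,\nu(dx)=\nu(B)$ for every Borel $B\subset S$, and locally finite if every point of $S$ has a neighbourhood, open in $S$, of finite measure. Then the mapping $$\mu\mapsto\mu_A^{entr}:=\int_{A^c}\mathbb P_x(Y_1\in\cdot)\,\mu(dx)\quad\text{on } A$$ is a bijection from the set of locally finite invariant Borel measures of $Y$ on $\mathcal X$ onto the set of locally finite invariant Borel measures of $Y^{\rangle A}$ on $A$, and the mapping $$\mu\mapsto\mu_{A^c}^{exit},\qquad \mu_{A^c}^{exit}(dx):=\mathbb P_x(Y_1\in A)\,\mu(dx)\quad\text{on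 } A^c,$$ is a bijection from the set of locally finite invariant Borel measures of $Y$ on $\mathcal X$ onto the set of locally finite invariant Borel measures of $Y^{A^c\rangle}$ on $A^c$. Moreover, all these invariant measures of $Y^{\rangle A}$ and $Y^{A^c\rangle}$ are proper: with $N_A=\{x:\mathbb P_x(Y_k\in A\text{ for infinitely many }k\text{ and }Y_k\in A^c\text{ for infinitely many }k)=1\}$, those of $Y^{\rangle A}$ vanish on $A\setminus N_A$, and those of $Y^{A^c\rangle}$ vanish on $A^c\setminus(N_A\cap\{x:\mathbb P_x(Y_1\in A)>0\})$. -/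

import Mathlib

open MeasureTheory ProbabilityTheory Set Filter

namespace EntranceExit

noncomputable section

section General

variable {X : Type*} [MeasurableSpace X]

/-- The law `ℙ_x(Y ∈ ·)` on the path space `ℕ → X` of the time-homogeneous Markov chain `Y`
with transition kernel `P` started at `x` (Ionescu-Tulcea extension). -/
def pathLaw (P : Kernel X X) [IsMarkovKernel P] : Kernel X (ℕ → X) :=
  (Kernel.traj (X := fun _ : ℕ => X)
      (fun n => P.comap (fun h : (i : Finset.Iic n) → X => h ⟨n, Finset.mem_Iic.2 le_rfl⟩)
        (measurable_pi_apply _)) 0).comap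
    (fun x _ => x) (measurable_pi_lambda _ fun _ => measurable_id)

/-- The event `{τ_G < ∞}`, where `τ_G = inf {n ≥ 1 : Y_n ∈ G}`. -/
def hits (G : Set X) : Set (ℕ → X) := {ω | ∃ n, 1 ≤ n ∧ ω n ∈ G}

/-- The successive entrance times into `A` from `Aᶜ`: `T_0 = 0` and
`T_{n+1} = inf {k > T_n : Y_{k-1} ∈ Aᶜ, Y_k ∈ A}`, with value `∞` if there is no such `k`. -/
def entranceTime (A : Set X) (ω : ℕ → X) : ℕ → ℕ∞
  | 0 => 0
  | n + 1 => ⨅ (k : ℕ) (_ : entranceTime A ω n < (k + 1 : ℕ) ∧ ω k ∉ A ∧ ω (k + 1) ∈ A),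
      ((k + 1 : ℕ) : ℕ∞)

/-- The position `Y_{T_n}` at the `n`-th entrance into `A`; used only where `T_n < ∞`. -/
def entrancePos (A : Set X) (n : ℕ) (ω : ℕ → X) : X := ω (entranceTime A ω n).toNat

/-- The position `Y_{T_n - 1}` at the `n`-th exit from `Aᶜ` to `A`; used only where
`1 ≤ T_n < ∞`. -/
def exitPos (A : Set X) (n : ℕ) (ω : ℕ → X) : X := ω ((entranceTime A ω n).toNat - 1)

lemma borelSpace_enat : BorelSpace ℕ∞ :=
  ⟨le_antisymm (fun s _ => by
    borelize ℕ∞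
    exact s.to_countable.measurableSet) le_top⟩

lemma measurable_entranceTime {A : Set X} (hA : MeasurableSet A) (n : ℕ) :
    Measurable (fun ω : ℕ → X => entranceTime A ω n) := by
  have := borelSpace_enat
  induction n with
  | zero => exact measurable_const
  | succ n ih =>
    refine Measurable.iInf fun k => ?_
    have hs : MeasurableSet {ω : ℕ → X |
        entranceTime A ω n < (k + 1 : ℕ) ∧ ω k ∉ A ∧ ω (k + 1) ∈ A} := by
      refine (ih (MeasurableSet.of_discrete (s := Iio ((k + 1 : ℕ) : ℕ∞)))).inter
        (MeasurableSet.inter ?_ (measurable_pi_apply (k + 1) hA))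
      exact (measurable_pi_apply k hA).compl
    classical
    have : (fun ω : ℕ → X =>
        ⨅ (_ : entranceTime A ω n < (k + 1 : ℕ) ∧ ω k ∉ A ∧ ω (k + 1) ∈ A), ((k + 1 : ℕ) : ℕ∞))
        = fun ω => if entranceTime A ω n < (k + 1 : ℕ) ∧ ω k ∉ A ∧ ω (k + 1) ∈ A
          then ((k + 1 : ℕ) : ℕ∞) else ⊤ := by
      funext ω
      split_ifs with h
      · exact iInf_pos h
      · exact iInf_neg h
    rw [this]
    exact Measurable.ite hs measurable_const measurable_const

lemma measurable_apply_of_measurable {f : (ℕ → X) → ℕ} (hf : Measurable f) :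
    Measurable (fun ω : ℕ → X => ω (f ω)) := by
  have h : Measurable (fun p : (ℕ → X) × ℕ => p.1 p.2) :=
    measurable_from_prod_countable_left fun n => measurable_pi_apply n
  exact h.comp (measurable_id.prodMk hf)

lemma measurable_entrancePos {A : Set X} (hA : MeasurableSet A) (n : ℕ) :
    Measurable (entrancePos A n : (ℕ → X) → X) :=
  measurable_apply_of_measurable
    ((measurable_from_top (f := ENat.toNat)).comp (measurable_entranceTime hA n))

lemma measurable_exitPos {A : Set X} (hA : MeasurableSet A) (n : ℕ) :
    Measurable (exitPos A n : (ℕ → X) → X) :=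
  measurable_apply_of_measurable
    ((measurable_from_top (f := fun t : ℕ∞ => t.toNat - 1)).comp (measurable_entranceTime hA n))

lemma measurableSet_entranceTime_lt_top {A : Set X} (hA : MeasurableSet A) (n : ℕ) :
    MeasurableSet {ω : ℕ → X | entranceTime A ω n < ⊤} :=
  measurable_entranceTime hA n (MeasurableSet.of_discrete (s := Iio ⊤))

/-- The transition kernel of the entrance chain on `A`:
`(x, B) ↦ ℙ_x(T_1 < ∞, Y_{T_1} ∈ B)` for `x ∈ A` and `B ⊆ A`. The remaining mass
`ℙ_x(T_1 = ∞)` is the probability of a jump to the cemetery state `†`, which is not in `A`. -/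
def entranceKernel (P : Kernel X X) [IsMarkovKernel P] (A : Set X) (hA : MeasurableSet A) :
    Kernel A A :=
  ((((pathLaw P).restrict (measurableSet_entranceTime_lt_top hA 1)).map
    (entrancePos A 1)).comapRight (MeasurableEmbedding.subtype_coe hA)).comap
      Subtype.val measurable_subtype_coe

/-- The kernel `(x, B) ↦ ℙ_x(Y_1 ∈ B | Y_1 ∈ A)`; it is the zero measure when
`ℙ_x(Y_1 ∈ A) = 0`. -/
def condKernel (P : Kernel X X) (A : Set X) (hA : MeasurableSet A) : Kernel X X where
  toFun x := cond (P x) A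
  measurable' := by
    refine Measure.measurable_of_measurable_coe _ fun B hB => ?_
    simp only [cond_apply hA]
    exact (P.measurable_coe hA).inv.mul (P.measurable_coe (hA.inter hB))

/-- The transition kernel of the exit chain on `Aᶜ`:
`(x, B) ↦ ∫_A ℙ_z(T_1 < ∞, Y_{T_1 - 1} ∈ B) ℙ_x(Y_1 ∈ dz | Y_1 ∈ A)` for `B ⊆ Aᶜ`. It vanishes
for `x ∈ Aᶜ` with `ℙ_x(Y_1 ∈ A) = 0`: from such a point, the chain jumps to the cemetery
state `†`, which again carries all the remaining mass. -/
def exitKernel (P : Kernel X X) [IsMarkovKernel P] (A : Set X) (hA : MeasurableSet A) :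
    Kernel (Aᶜ : Set X) (Aᶜ : Set X) :=
  (((((pathLaw P).restrict (measurableSet_entranceTime_lt_top hA 1)).map
    (exitPos A 1)).comp (condKernel P A hA)).comapRight
      (MeasurableEmbedding.subtype_coe hA.compl)).comap Subtype.val measurable_subtype_coe

/-- The entrance measure `∫_{Aᶜ} ℙ_x(Y_1 ∈ ·) μ(dx)` on `A`. -/
def entranceMeasure (P : Kernel X X) (A : Set X) (μ : Measure X) : Measure A :=
  ((μ.restrict Aᶜ).bind P).comap Subtype.val

/-- The exit measure `ℙ_x(Y_1 ∈ A) μ(dx)` on `Aᶜ`. -/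
def exitMeasure (P : Kernel X X) (A : Set X) (μ : Measure X) : Measure (Aᶜ : Set X) :=
  (μ.withDensity fun x => P x A).comap Subtype.val

/-- The set `N_A` of starting points from which `Y` a.s. visits both `A` and `Aᶜ` infinitely
often. -/
def visitsBothSet (P : Kernel X X) [IsMarkovKernel P] (A : Set X) : Set X :=
  {x | pathLaw P x {ω | (∃ᶠ k in atTop, ω k ∈ A) ∧ (∃ᶠ k in atTop, ω k ∈ Aᶜ)} = 1}

/-- The exit set of `B`: the points of `B` from which `Y` leaves `B` in one step with positive
probability. -/
def exitSet (P : Kernel X X) (B : Set X) : Set X := {x ∈ B | 0 < P x Bᶜ}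

/-- A measure on `A` is proper for the entrance chain if it does not charge `A \ N_A`. -/
def ProperEntrance (P : Kernel X X) [IsMarkovKernel P] (A : Set X) (ν : Measure A) : Prop :=
  ν {x | (x : X) ∉ visitsBothSet P A} = 0

/-- A measure on `Aᶜ` is proper for the exit chain if it is carried by the points of
`N_A` that belong to the exit set of `Aᶜ`. -/
def ProperExit (P : Kernel X X) [IsMarkovKernel P] (A : Set X)
    (ν : Measure (Aᶜ : Set X)) : Prop :=
  ν {x | (x : X) ∉ exitSet P Aᶜ ∩ visitsBothSet P A} = 0

/-- The locally finite invariant (Borel) measures of the chain with transition kernel `κ`,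
the zero measure included. Invariance means `∫ κ(x, B) ν(dx) = ν(B)` for all measurable `B`. -/
def locallyFiniteInvariant {S : Type*} [TopologicalSpace S] [MeasurableSpace S]
    (κ : Kernel S S) : Set (Measure S) :=
  {ν | IsLocallyFiniteMeasure ν ∧ κ.Invariant ν}

end General

section Topological

variable {X : Type*} [TopologicalSpace X] [MeasurableSpace X]

/-- From every point, every non-empty open set is hit with positive probability. -/
def TopologicallyIrreducible (P : Kernel X X) [IsMarkovKernel P] : Prop :=
  ∀ x : X, ∀ G : Set X, IsOpen G → G.Nonempty → 0 < pathLaw P x (hits G)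

/-- Every open set is revisited almost surely when starting from any of its points. -/
def TopologicallyRecurrent (P : Kernel X X) [IsMarkovKernel P] : Prop :=
  ∀ G : Set X, IsOpen G → ∀ x ∈ G, pathLaw P x (hits G) = 1

/-- `x ↦ 𝔼_x f(Y_1)` is continuous for every bounded continuous `f : X → ℝ`. -/
def WeakFeller (P : Kernel X X) : Prop :=
  ∀ f : BoundedContinuousFunction X ℝ, Continuous fun x => ∫ y, f y ∂(P x)

end Topological

end

end EntranceExit

/-! Split the transition kernel as P = Q + R, where R keeps only the steps from Aᶜ into A and Q all
the others, and let G = ∑ Qⁿ. A path decomposition at the first entrance (`pathLaw_entrance`) shows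
that the entrance kernel is "G, then R". The exit kernel is "a step conditioned to land in A, then G
weighted by the density R(·, X)". The entrance measure of μ is μR, the exit measure has density R(·,
X), and conditioning turns the latter into the former (`withDensity_bind_condKernel`). Both
bijections therefore reduce to one formula, μ = μRG, for every locally finite invariant μ
(`bind_jumpKernel_bind_greenKernel`).

To prove it, put ν = μR and μ' = νG. Iterating μ = μQ + ν gives μ' ≤ μ, hence μ'R ≤ ν. Write ν = μ'R
+ η. Since μ' = ν + μ'Q, it follows that μ' = μ'P + η. Iteration gives η ∑ Pⁿ ≤ μ'; recurrence makes
∑ Pⁿ(y, U) infinite for every y and every non-empty open U, so η = 0 by local finiteness. Thus μ' is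
invariant, and so is ρ = μ - μ', with ρR = 0. From every point a jump from Aᶜ into A has positive
probability at some time, so ρ = 0.

Conversely, if ν is invariant for the entrance chain then νG is invariant for P, and its image is ν.
It is locally finite because an invariant measure finite on one non-empty open set is locally finite
(`isLocallyFiniteMeasure_of_invariant`).

For properness, a weak Feller, irreducible and recurrent chain visits every non-empty open set
infinitely often from every starting point (`pathLaw_visitsInfinitely`). As A and Aᶜ both have
non-empty interior, N_A is the whole space. -/

namespace EntranceExit

open Preorder Topology
open scoped ENNReal

/-! ### The Markov property of the path law -/

section PathMarkov

variable {X : Type*} [MeasurableSpace X]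

/-- The past of a path up to time `b`. -/
abbrev past (b : ℕ) (ω : ℕ → X) : Finset.Iic b → X := fun i => ω i

/-- A measure on path space satisfying the Markov property with transition kernel `P` at every
time, with respect to the whole past. -/
def IsMarkovPath (P : Kernel X X) (m : Measure (ℕ → X)) : Prop :=
  ∀ (b : ℕ) (S : Set (((i : Finset.Iic b) → X) × X)), MeasurableSet S →
    m {ω | (past b ω, ω (b + 1)) ∈ S} = ∫⁻ ω, P (ω b) {z | (past b ω, z) ∈ S} ∂m

/-- Extend a path up to time `b` by one position. -/
def snocPath (b : ℕ) (p : ((i : Finset.Iic b) → X) × X) : Finset.Iic (b + 1) → X :=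
  fun i => if h : (i : ℕ) ≤ b then p.1 ⟨i, Finset.mem_Iic.2 h⟩ else p.2

lemma measurable_past (b : ℕ) : Measurable (past (X := X) b) :=
  measurable_pi_lambda _ fun _ => measurable_pi_apply _

lemma measurable_snocPath (b : ℕ) : Measurable (snocPath (X := X) b) := by
  refine measurable_pi_lambda _ fun i => ?_
  unfold snocPath
  split_ifs
  · fun_prop
  · fun_prop

omit [MeasurableSpace X] in
lemma snocPath_past (b : ℕ) (ω : ℕ → X) :
    snocPath b (past b ω, ω (b + 1)) = past (b + 1) ω := by
  ext i
  have := Finset.mem_Iic.1 i.2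
  unfold snocPath
  split_ifs with h
  · rfl
  · have : (i : ℕ) = b + 1 := by lia
    simp [past, this]

lemma measurable_kernel_last (P : Kernel X X) [IsMarkovKernel P] (b : ℕ)
    {S : Set (((i : Finset.Iic b) → X) × X)} (hS : MeasurableSet S) :
    Measurable fun h : (i : Finset.Iic b) → X =>
      P (h ⟨b, Finset.mem_Iic.2 le_rfl⟩) {z | (h, z) ∈ S} := by
  have := Kernel.measurable_kernel_prodMk_left
    (κ := P.comap (fun h : (i : Finset.Iic b) → X => h ⟨b, Finset.mem_Iic.2 le_rfl⟩)
        (measurable_pi_apply _)) hS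
  exact this

lemma measurable_kernel_past (P : Kernel X X) [IsMarkovKernel P] (b : ℕ)
    {S : Set (((i : Finset.Iic b) → X) × X)} (hS : MeasurableSet S) :
    Measurable fun ω : ℕ → X => P (ω b) {z | (past b ω, z) ∈ S} :=
  (measurable_kernel_last P b hS).comp (measurable_past b)

lemma measurableSet_past_prod (b : ℕ) {S : Set (((i : Finset.Iic b) → X) × X)}
    (hS : MeasurableSet S) : MeasurableSet {ω : ℕ → X | (past b ω, ω (b + 1)) ∈ S} :=
  ((measurable_past (X := X) b).prodMk (measurable_pi_apply (b + 1))) hS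

lemma IsMarkovPath.eq_of_map_zero {P : Kernel X X} [IsMarkovKernel P] {m₁ m₂ : Measure (ℕ → X)}
    [IsFiniteMeasure m₁] [IsFiniteMeasure m₂] (h₁ : IsMarkovPath P m₁) (h₂ : IsMarkovPath P m₂)
    (h0 : m₁.map (fun ω => ω 0) = m₂.map (fun ω => ω 0)) : m₁ = m₂ := by
  have key : ∀ b, m₁.map (past b) = m₂.map (past b) := by
    intro b
    induction b with
    | zero =>
      have hf : Measurable (fun (x : X) (_ : Finset.Iic 0) => x) :=
        measurable_pi_lambda _ fun _ => measurable_id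
      have e : past (X := X) 0 =
          (fun (x : X) (_ : Finset.Iic 0) => x) ∘ (fun ω : ℕ → X => ω 0) := by
        ext ω i
        have : (i : ℕ) = 0 := Nat.le_zero.1 (Finset.mem_Iic.1 i.2)
        simp [past, this]
      rw [e, ← Measure.map_map hf (measurable_pi_apply 0),
        ← Measure.map_map hf (measurable_pi_apply 0), h0]
    | succ b ih =>
      ext S hS
      rw [Measure.map_apply (measurable_past _) hS,
        Measure.map_apply (measurable_past _) hS]
      have hS' := measurable_snocPath b hS
      have e : past (X := X) (b + 1) ⁻¹' S =
          {ω | (past b ω, ω (b + 1)) ∈ snocPath b ⁻¹' S} := by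
        ext ω
        simp only [mem_preimage, mem_ofPred_eq, snocPath_past]
      have hm := measurable_kernel_last P b hS'
      have e2 : ∀ m : Measure (ℕ → X), ∫⁻ ω, P (ω b) {z | (past b ω, z) ∈ snocPath b ⁻¹' S} ∂m
          = ∫⁻ h, P (h ⟨b, Finset.mem_Iic.2 le_rfl⟩) {z | (h, z) ∈ snocPath b ⁻¹' S}
            ∂(m.map (past b)) := by
        intro m
        rw [lintegral_map hm (measurable_past _)]
      rw [e, h₁ b _ hS', h₂ b _ hS', e2, e2, ih]
  -- Both measures are projective limits of the finite-dimensional marginals of m₂, and such a limit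
  -- is unique.
  have hp : IsProjectiveMeasureFamily (fun I : Finset ℕ => m₂.map I.restrict) := by
    intro I J hJI
    rw [Measure.map_map (Finset.measurable_restrict₂ _) (Finset.measurable_restrict _)]
    rfl
  have hl : IsProjectiveLimit m₁ (fun I : Finset ℕ => m₂.map I.restrict) :=
    (isProjectiveLimit_nat_iff hp m₁).2 key
  have hl2 : IsProjectiveLimit m₂ (fun I : Finset ℕ => m₂.map I.restrict) := fun I => rfl
  have : ∀ I : Finset ℕ, IsFiniteMeasure ((fun I : Finset ℕ => m₂.map I.restrict) I) := by
    intro I; dsimp; infer_instance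
  exact hl.unique hl2

/-- The time shift on path space. -/
def shift (ω : ℕ → X) : ℕ → X := fun n => ω (n + 1)

lemma measurable_shift : Measurable (shift : (ℕ → X) → ℕ → X) :=
  measurable_pi_lambda _ fun n => measurable_pi_apply (n + 1)

variable (P : Kernel X X) [IsMarkovKernel P]

instance : IsMarkovKernel (pathLaw P) := by unfold pathLaw; infer_instance

lemma isMarkovPath_pathLaw (x : X) : IsMarkovPath P (pathLaw P x) := by
  intro b S hS
  let κ : (n : ℕ) → Kernel ((i : Finset.Iic n) → X) X := fun n =>
    P.comap (fun h : (i : Finset.Iic n) → X => h ⟨n, Finset.mem_Iic.2 le_rfl⟩)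
        (measurable_pi_apply _)
  have h := Kernel.partialTraj_compProd_eq_map_traj (X := fun _ : ℕ => X) (κ := κ)
    (a := 0) (b := b) (Nat.zero_le _) (x₀ := fun _ => x)
  have h' := congrArg (fun m => m S) h
  rw [Measure.map_apply (by fun_prop) hS, Measure.compProd_apply hS,
    ← Kernel.traj_map_frestrictLe_apply, lintegral_map] at h'
  · exact h'.symm
  · exact Kernel.measurable_kernel_prodMk_left hS
  · exact measurable_frestrictLe _

lemma pathLaw_map_zero (x : X) : (pathLaw P x).map (fun ω => ω 0) = Measure.dirac x := by
  let κ : (n : ℕ) → Kernel ((i : Finset.Iic n) → X) X := fun n =>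
    P.comap (fun h : (i : Finset.Iic n) → X => h ⟨n, Finset.mem_Iic.2 le_rfl⟩)
        (measurable_pi_apply _)
  have h := Kernel.traj_map_frestrictLe_apply (X := fun _ : ℕ => X) (κ := κ) 0 0 (fun _ => x)
  rw [Kernel.partialTraj_self, Kernel.id_apply] at h
  have h0 : Measurable
      (fun h : (i : Finset.Iic 0) → X => h ⟨0, Finset.mem_Iic.2 le_rfl⟩) := measurable_pi_apply _
  have h' := congrArg (Measure.map
    (fun h : (i : Finset.Iic 0) → X => h ⟨0, Finset.mem_Iic.2 le_rfl⟩)) h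
  rw [Measure.map_map h0 (measurable_frestrictLe _)] at h'
  exact h'.trans (Measure.map_dirac' h0 _)

lemma pathLaw_zero_mem_ae (x : X) {B : Set X} (hB : MeasurableSet B) :
    ∀ᵐ ω ∂(pathLaw P x), (ω 0 ∈ B ↔ x ∈ B) := by
  have h : ∀ᵐ y ∂((pathLaw P x).map fun ω => ω 0), (y ∈ B ↔ x ∈ B) := by
    rw [pathLaw_map_zero]
    by_cases hx : x ∈ B
    · filter_upwards [(ae_dirac_iff hB).2 hx] with y hy using iff_of_true hy hx
    · filter_upwards [(ae_dirac_iff hB.compl).2 hx] with y hy using iff_of_false hy hx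
  exact ae_of_ae_map (measurable_pi_apply 0).aemeasurable h

lemma pathLaw_map_one (x : X) : (pathLaw P x).map (fun ω => ω 1) = P x := by
  ext B hB
  rw [Measure.map_apply (measurable_pi_apply _) hB]
  have := isMarkovPath_pathLaw P x 0 (Prod.snd ⁻¹' B) (measurable_snd hB)
  simp only [mem_preimage, zero_add] at this
  change _ = ∫⁻ ω, P (ω 0) B ∂(pathLaw P x) at this
  change pathLaw P x {ω | ω 1 ∈ B} = _
  rw [this, ← lintegral_map (f := fun y => P y B) (P.measurable_coe hB) (measurable_pi_apply 0),
    pathLaw_map_zero, lintegral_dirac' _ (P.measurable_coe hB)]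

/-- The Markov property at time one. -/
theorem pathLaw_map_shift (x : X) : (pathLaw P x).map shift = (P x).bind (pathLaw P) := by
  have : IsProbabilityMeasure ((pathLaw P x).map shift) :=
    Measure.isProbabilityMeasure_map measurable_shift.aemeasurable
  refine IsMarkovPath.eq_of_map_zero (P := P) ?_ ?_ ?_
  · intro b S hS
    -- g forgets the position at time 0 and renumbers, turning the past up to b + 1 into the past up
    -- to b of the shifted path.
    let g : ((i : Finset.Iic (b + 1)) → X) → ((i : Finset.Iic b) → X) := fun h i =>
      h ⟨i + 1, Finset.mem_Iic.2 (Nat.succ_le_succ (Finset.mem_Iic.1 i.2))⟩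
    have hg : Measurable g := measurable_pi_lambda _ fun i => measurable_pi_apply _
    have h := isMarkovPath_pathLaw P x (b + 1) (Prod.map g id ⁻¹' S)
      ((hg.prodMap measurable_id) hS)
    rw [Measure.map_apply measurable_shift (measurableSet_past_prod b hS),
      lintegral_map (measurable_kernel_past P b hS) measurable_shift]
    exact h
  · intro b S hS
    rw [Measure.bind_apply (measurableSet_past_prod b hS) (Kernel.aemeasurable _),
      Measure.lintegral_bind (Kernel.aemeasurable _)
      (measurable_kernel_past P b hS).aemeasurable]
    exact lintegral_congr fun y => isMarkovPath_pathLaw P y b S hS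
  · rw [Measure.map_map (measurable_pi_apply 0) measurable_shift]
    change (pathLaw P x).map (fun ω => ω 1) = _
    rw [pathLaw_map_one]
    ext B hB
    rw [Measure.map_apply (measurable_pi_apply 0) hB,
      Measure.bind_apply (measurable_pi_apply 0 hB) (Kernel.aemeasurable _)]
    have : ∀ y, pathLaw P y ((fun ω : ℕ → X => ω 0) ⁻¹' B) = B.indicator 1 y := fun y => by
      rw [← Measure.map_apply (measurable_pi_apply 0) hB, pathLaw_map_zero, Measure.dirac_apply' _ hB]
    simp_rw [this]
    rw [lintegral_indicator_one hB]

lemma pathLaw_preimage_shift (x : X) {S : Set (ℕ → X)} (hS : MeasurableSet S) :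
    pathLaw P x (shift ⁻¹' S) = ∫⁻ y, pathLaw P y S ∂(P x) := by
  rw [← Measure.map_apply measurable_shift hS, pathLaw_map_shift,
    Measure.bind_apply hS (Kernel.aemeasurable _)]

end PathMarkov

instance isMarkovKernel_pow {X : Type*} [MeasurableSpace X] (P : Kernel X X) [IsMarkovKernel P]
    (n : ℕ) : IsMarkovKernel (P ^ n) := by
  induction n with
  | zero => rw [pow_zero]; exact inferInstanceAs (IsMarkovKernel Kernel.id)
  | succ n ih => rw [pow_succ]; exact inferInstanceAs (IsMarkovKernel ((P ^ n) ∘ₖ P))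

/-! ### Recurrence: from hitting a set to visiting it infinitely often -/

section Recurrence

variable {X : Type*} [MeasurableSpace X] (P : Kernel X X) [IsMarkovKernel P]

lemma lintegral_pow_succ (Q : Kernel X X) (n : ℕ) (x : X) {f : X → ℝ≥0∞} (hf : Measurable f) :
    ∫⁻ y, f y ∂((Q ^ (n + 1)) x) = ∫⁻ y, ∫⁻ z, f z ∂((Q ^ n) y) ∂(Q x) := by
  rw [pow_succ]
  exact Kernel.lintegral_comp (Q ^ n) Q x hf

lemma pathLaw_preimage_shift_iterate (n : ℕ) (x : X) {S : Set (ℕ → X)} (hS : MeasurableSet S) :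
    pathLaw P x (shift^[n] ⁻¹' S) = ∫⁻ y, pathLaw P y S ∂((P ^ n) x) := by
  induction n generalizing x with
  | zero =>
    rw [pow_zero]
    change _ = ∫⁻ y, pathLaw P y S ∂(Kernel.id x)
    rw [Kernel.id_apply, lintegral_dirac' _ (Kernel.measurable_coe _ hS)]
    rfl
  | succ n ih =>
    rw [Function.iterate_succ, preimage_comp, pathLaw_preimage_shift P x
      ((measurable_shift.iterate n) hS), lintegral_pow_succ _ _ _ (Kernel.measurable_coe _ hS)]
    exact lintegral_congr ih

omit [MeasurableSpace X] in
lemma shift_iterate_apply (n k : ℕ) (ω : ℕ → X) : shift^[n] ω k = ω (k + n) := by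
  induction n generalizing ω with
  | zero => rfl
  | succ n ih =>
    rw [Function.iterate_succ_apply, ih]
    simp only [shift]
    congr 1

lemma pathLaw_inter_zero (x : X) {B : Set X} (hB : MeasurableSet B) (S : Set (ℕ → X)) :
    pathLaw P x ({ω | ω 0 ∈ B} ∩ S) = B.indicator (fun y => pathLaw P y S) x := by
  by_cases hx : x ∈ B
  · rw [indicator_of_mem hx]
    refine measure_congr ?_
    filter_upwards [pathLaw_zero_mem_ae P x hB] with ω hω
    exact propext ⟨fun h => h.2, fun h => ⟨hω.2 hx, h⟩⟩
  · rw [indicator_of_notMem hx, measure_eq_zero_iff_ae_notMem]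
    filter_upwards [pathLaw_zero_mem_ae P x hB] with ω hω h
    exact hx (hω.1 h.1)

lemma pathLaw_apply_mem (n : ℕ) (x : X) {B : Set X} (hB : MeasurableSet B) :
    pathLaw P x {ω | ω n ∈ B} = (P ^ n) x B := by
  have h0 : MeasurableSet {ω : ℕ → X | ω 0 ∈ B} := measurable_pi_apply 0 hB
  have e : {ω : ℕ → X | ω n ∈ B} = shift^[n] ⁻¹' {ω | ω 0 ∈ B} := by
    ext ω
    simp [shift_iterate_apply]
  rw [e, pathLaw_preimage_shift_iterate P n x h0, ← lintegral_indicator_one hB]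
  refine lintegral_congr fun y => ?_
  have := pathLaw_inter_zero P y hB univ
  rw [inter_univ] at this
  simp [this, indicator]

/-- The event that the set `G` is visited infinitely often. -/
def visitsInfinitely (G : Set X) : Set (ℕ → X) := {ω | ∃ᶠ k in atTop, ω k ∈ G}

/-- The event that the set `G` is not visited at the times `1, …, n`. -/
def avoidsUpTo (G : Set X) (n : ℕ) : Set (ℕ → X) := {ω | ∀ k < n, ω (k + 1) ∉ G}

variable {G U : Set X}

lemma measurableSet_visitsInfinitely (hG : MeasurableSet G) :
    MeasurableSet (visitsInfinitely G) := by
  have : visitsInfinitely G = limsup (fun k => {ω : ℕ → X | ω k ∈ G}) atTop := by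
    ext ω; rw [mem_limsup_iff_frequently_mem]; rfl
  rw [this]
  exact MeasurableSet.measurableSet_limsup fun k => measurable_pi_apply k hG

lemma measurableSet_hits (hG : MeasurableSet G) : MeasurableSet (hits G) := by
  have : hits G = ⋃ n, ⋃ (_ : 1 ≤ n), {ω : ℕ → X | ω n ∈ G} := by
    ext ω; simp [hits]
  rw [this]
  exact .iUnion fun n => .iUnion fun _ => measurable_pi_apply n hG

lemma measurableSet_avoidsUpTo (hG : MeasurableSet G) (n : ℕ) :
    MeasurableSet (avoidsUpTo G n) := by
  have : avoidsUpTo G n = ⋂ k, ⋂ (_ : k < n), {ω : ℕ → X | ω (k + 1) ∈ Gᶜ} := by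
    ext ω; simp [avoidsUpTo]
  rw [this]
  exact .iInter fun n => .iInter fun _ => measurable_pi_apply (n + 1) hG.compl

omit [MeasurableSpace X] in
lemma visitsInfinitely_subset_hits : visitsInfinitely G ⊆ hits G := fun _ h =>
  let ⟨n, hn, hG⟩ := frequently_atTop.1 h 1
  ⟨n, hn, hG⟩

omit [MeasurableSpace X] in
lemma preimage_shift_visitsInfinitely :
    shift ⁻¹' (visitsInfinitely G) = visitsInfinitely G := by
  ext ω
  have h := frequently_map (m := fun k : ℕ => k + 1) (f := atTop) (P := fun k => ω k ∈ G)
  rw [map_add_atTop_eq_nat] at h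
  exact h.symm

omit [MeasurableSpace X] in
-- If there are visits, but only finitely many, there is a last one; the path shifted to that time
-- starts in G and never returns.
lemma hits_diff_visitsInfinitely_subset : hits G \ visitsInfinitely G ⊆
    ⋃ n, shift^[n] ⁻¹' ({ω | ω 0 ∈ G} ∩ (hits G)ᶜ) := by
  classical
  rintro ω ⟨⟨n, -, hn⟩, h⟩
  obtain ⟨N, hN⟩ := eventually_atTop.1 (not_frequently.1 h)
  have hb : ∀ k, ω k ∈ G → k ≤ N := fun k hk => by
    by_contra hlt
    exact hN k (by lia) hk
  have hspec := Nat.findGreatest_spec (P := fun k => ω k ∈ G) (hb n hn) hn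
  refine mem_iUnion.2 ⟨Nat.findGreatest (fun k => ω k ∈ G) N, ?_, ?_⟩
  · simpa [shift_iterate_apply] using hspec
  · rintro ⟨m, hm, hmG⟩
    rw [shift_iterate_apply] at hmG
    have := Nat.le_findGreatest (P := fun k => ω k ∈ G) (hb _ hmG) hmG
    lia

lemma pathLaw_hits_diff (hG : MeasurableSet G) (hr : ∀ x ∈ G, pathLaw P x (hits G) = 1) (x : X) :
    pathLaw P x (hits G \ visitsInfinitely G) = 0 := by
  refine measure_mono_null hits_diff_visitsInfinitely_subset (measure_iUnion_null fun n => ?_)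
  have hm : MeasurableSet {ω : ℕ → X | ω 0 ∈ G} := measurable_pi_apply 0 hG
  rw [pathLaw_preimage_shift_iterate P n x (hm.inter (measurableSet_hits hG).compl)]
  refine (lintegral_congr fun y => ?_).trans lintegral_zero
  rw [pathLaw_inter_zero P y hG]
  by_cases hy : y ∈ G
  · rw [indicator_of_mem hy, prob_compl_eq_zero_iff (measurableSet_hits hG)]
    exact hr y hy
  · exact indicator_of_notMem hy _

lemma pathLaw_avoidsUpTo_succ (hG : MeasurableSet G) (n : ℕ) (x : X) :
    pathLaw P x (avoidsUpTo G (n + 1)) = ∫⁻ y in Gᶜ, pathLaw P y (avoidsUpTo G n) ∂(P x) := by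
  have h0 : MeasurableSet {ω : ℕ → X | ω 0 ∈ Gᶜ} := measurable_pi_apply 0 hG.compl
  have e : avoidsUpTo G (n + 1) = shift ⁻¹' ({ω | ω 0 ∈ Gᶜ} ∩ avoidsUpTo G n) := by
    ext ω
    constructor
    · exact fun h => ⟨h 0 (by lia), fun k hk => h (k + 1) (by lia)⟩
    · rintro ⟨h0, h⟩ k hk
      cases k with
      | zero => exact h0
      | succ k => exact h k (by lia)
  rw [e, pathLaw_preimage_shift P x (h0.inter (measurableSet_avoidsUpTo hG n)),
    ← lintegral_indicator hG.compl]
  exact lintegral_congr fun y => pathLaw_inter_zero P y hG.compl _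

lemma tendsto_pathLaw_avoidsUpTo (hG : MeasurableSet G) (x : X) :
    Tendsto (fun n => pathLaw P x (avoidsUpTo G n)) atTop (𝓝 (pathLaw P x (hits G)ᶜ)) := by
  have e : (hits G)ᶜ = ⋂ n, avoidsUpTo G n := by
    ext ω
    simp only [hits, avoidsUpTo, mem_compl_iff, mem_iInter, mem_ofPred_eq, not_exists, not_and]
    constructor
    · exact fun h n k _ => h (k + 1) (by lia)
    · intro h n hn
      have := h n (n - 1) (by lia)
      rwa [Nat.sub_add_cancel hn] at this
  rw [e]
  refine tendsto_measure_iInter_atTop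
    (fun n => (measurableSet_avoidsUpTo hG n).nullMeasurableSet) ?_ ⟨0, measure_ne_top _ _⟩
  exact fun m n hmn ω h k hk => h k (by lia)

/-- A bounded harmonic function is controlled by its bound on `U` and the probability of
avoiding `U`. -/
lemma harmonic_le_add_avoids (hU : MeasurableSet U) {f : X → ℝ≥0∞} (hf1 : ∀ x, f x ≤ 1)
    (hfP : ∀ x, ∫⁻ y, f y ∂(P x) = f x) {b : ℝ≥0∞} (hb : ∀ x ∈ U, f x ≤ b) (x : X) :
    f x ≤ b + pathLaw P x (hits U)ᶜ := by
  have key : ∀ n x, f x ≤ b + pathLaw P x (avoidsUpTo U n) := by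
    intro n
    induction n with
    | zero =>
      intro x
      have : avoidsUpTo U 0 = univ := by ext; simp [avoidsUpTo]
      rw [this, measure_univ]
      exact (hf1 x).trans le_add_self
    | succ n ih =>
      intro x
      rw [← hfP x, ← lintegral_add_compl _ hU, pathLaw_avoidsUpTo_succ P hU]
      calc ∫⁻ y in U, f y ∂(P x) + ∫⁻ y in Uᶜ, f y ∂(P x)
          ≤ ∫⁻ y in U, b ∂(P x) +
            ∫⁻ y in Uᶜ, (b + pathLaw P y (avoidsUpTo U n)) ∂(P x) :=
            add_le_add (setLIntegral_mono measurable_const hb) (lintegral_mono ih)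
        _ = b + ∫⁻ y in Uᶜ, pathLaw P y (avoidsUpTo U n) ∂(P x) := by
            rw [lintegral_add_left measurable_const, ← add_assoc, lintegral_add_compl _ hU]
            simp
  exact ge_of_tendsto' ((tendsto_pathLaw_avoidsUpTo P hU x).const_add b) fun n => key n x

/-- As f vanishes on G, each step of its mean-value identity only integrates over Gᶜ, which builds
up the avoidance probability in front of b. The error u is simply propagated by the unrestricted
chain. -/
lemma harmonic_le_mul_avoidsUpTo (hG : MeasurableSet G) {f u : X → ℝ≥0∞} (hu : Measurable u)
    (hfP : ∀ x, ∫⁻ y, f y ∂(P x) = f x) (hfG : ∀ x ∈ G, f x = 0)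
    {b : ℝ≥0∞} (hfu : ∀ x, f x ≤ b + u x) (n : ℕ) (x : X) :
    f x ≤ b * pathLaw P x (avoidsUpTo G n) + ∫⁻ y, u y ∂((P ^ n) x) := by
  induction n generalizing x with
  | zero =>
    have : avoidsUpTo G 0 = univ := by ext; simp [avoidsUpTo]
    rw [this, measure_univ, mul_one, pow_zero]
    change _ ≤ b + ∫⁻ y, u y ∂(Kernel.id x)
    rw [Kernel.id_apply, lintegral_dirac' _ hu]
    exact hfu x
  | succ n ih =>
    rw [← hfP x, ← lintegral_add_compl _ hG, setLIntegral_congr_fun hG hfG, lintegral_zero,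
      zero_add, pathLaw_avoidsUpTo_succ P hG, lintegral_pow_succ _ _ _ hu,
      ← lintegral_const_mul _ (Kernel.measurable_coe _ (measurableSet_avoidsUpTo hG n))]
    refine (lintegral_mono ih).trans ?_
    rw [lintegral_add_left ((Kernel.measurable_coe _ (measurableSet_avoidsUpTo hG n)).const_mul b)]
    gcongr
    exact Measure.restrict_le_self

/-- If the recurrent set `G` is hit within `N` steps with probability bounded below on a recurrent
set `U`, then `G` is a.s. visited infinitely often from the points of `U`. -/
lemma pathLaw_visitsInfinitely_of_le (hG : MeasurableSet G)
    (hrG : ∀ x ∈ G, pathLaw P x (hits G) = 1) (hU : MeasurableSet U)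
    (hrU : ∀ x ∈ U, pathLaw P x (hits U) = 1) {δ : ℝ≥0∞} (hδ : δ ≠ 0)
    (hUG : ∀ x ∈ U, δ ≤ pathLaw P x (hits G)) {x : X} (hx : x ∈ U) :
    pathLaw P x (visitsInfinitely G) = 1 := by
  have hmG := measurableSet_visitsInfinitely hG
  have hmU := measurableSet_visitsInfinitely hU
  set f : X → ℝ≥0∞ := fun y => pathLaw P y (visitsInfinitely G)ᶜ with hf
  have hfh : ∀ y, f y = pathLaw P y (hits G)ᶜ := by
    intro y
    refine measure_congr ?_
    have := measure_eq_zero_iff_ae_notMem.1 (pathLaw_hits_diff P hG hrG y)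
    filter_upwards [this] with ω hω
    exact propext ⟨fun h h' => hω ⟨h', h⟩, fun h h' => h (visitsInfinitely_subset_hits h')⟩
  -- Harmonicity comes from the shift invariance of the event of infinitely many visits.
  have hfP : ∀ y, ∫⁻ z, f z ∂(P y) = f y := by
    intro y
    rw [hf, ← pathLaw_preimage_shift P y hmG.compl, preimage_compl,
      preimage_shift_visitsInfinitely]
  have hfG : ∀ y ∈ G, f y = 0 := by
    intro y hy
    rw [hfh, prob_compl_eq_zero_iff (measurableSet_hits hG)]
    exact hrG y hy
  have hfb : ∀ y ∈ U, f y ≤ 1 - δ := by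
    intro y hy
    rw [hfh, prob_compl_eq_one_sub (measurableSet_hits hG)]
    exact tsub_le_tsub_left (hUG y hy) 1
  have hfu := harmonic_le_add_avoids P hU (fun _ => prob_le_one) hfP hfb
  have hle : ∀ n, f x ≤ (1 - δ) * pathLaw P x (avoidsUpTo G n) := by
    intro n
    have := harmonic_le_mul_avoidsUpTo P hG
      (Kernel.measurable_coe _ (measurableSet_hits hU).compl) hfP hfG hfu n x
    rw [← pathLaw_preimage_shift_iterate P n x (measurableSet_hits hU).compl] at this
    -- From x in U the path visits U infinitely often, so visits after time n are almost sure and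
    -- the error term disappears.
    have h0 : pathLaw P x (shift^[n] ⁻¹' (hits U)ᶜ) = 0 := by
      have h1 : pathLaw P x (hits U)ᶜ = 0 :=
        (prob_compl_eq_zero_iff (measurableSet_hits hU)).2 (hrU x hx)
      refine measure_mono_null ?_ (measure_union_null h1 (pathLaw_hits_diff P hU hrU x))
      intro ω hω
      by_cases h : ω ∈ hits U
      · refine Or.inr ⟨h, fun h' => hω ?_⟩
        obtain ⟨m, hm, hmU⟩ := frequently_atTop.1 h' (n + 1)
        refine ⟨m - n, by lia, ?_⟩
        rw [shift_iterate_apply, Nat.sub_add_cancel (by lia)]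
        exact hmU
      · exact Or.inl h
    rwa [h0, add_zero] at this
  -- As n → ∞ the avoidance probability tends to that of never hitting G, which is f x itself; the
  -- strict contraction by 1 - δ then forces f x = 0.
  have hlim : f x ≤ (1 - δ) * f x := by
    rw [hfh x] at hle ⊢
    exact ge_of_tendsto' (ENNReal.Tendsto.const_mul (tendsto_pathLaw_avoidsUpTo P hG x)
      (Or.inr (by finiteness))) hle
  have hfx : f x = 0 := by
    by_contra hne
    have : (1 - δ) * f x < 1 * f x :=
      ENNReal.mul_lt_mul_left hne (measure_ne_top _ _)
        (ENNReal.sub_lt_self ENNReal.one_ne_top one_ne_zero hδ)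
    rw [one_mul] at this
    exact absurd hlim (not_le.2 this)
  exact (prob_compl_eq_zero_iff hmG).1 hfx

end Recurrence

/-! ### Consequences of the weak Feller property -/

section Feller

variable {X : Type*} [TopologicalSpace X] [MeasurableSpace X] [OpensMeasurableSpace X]
  {P : Kernel X X} [IsMarkovKernel P]

lemma WeakFeller.pow (h : WeakFeller P) (n : ℕ) : WeakFeller (P ^ n) := by
  induction n with
  | zero =>
    intro f
    rw [pow_zero]
    change Continuous fun x => ∫ y, f y ∂(Kernel.id x)
    simp only [Kernel.id_apply]
    convert f.continuous using 2 with x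
    exact integral_dirac' _ _ f.continuous.stronglyMeasurable
  | succ n ih =>
    intro f
    have hb : ∀ x, ‖∫ y, f y ∂((P ^ n) x)‖ ≤ ‖f‖ := fun x => by
      refine (norm_integral_le_of_norm_le_const (ae_of_all _ f.norm_coe_le_norm)).trans ?_
      simp
    have hc := h (BoundedContinuousFunction.ofNormedAddCommGroup _ (ih f) ‖f‖ hb)
    convert hc using 2 with x
    rw [pow_succ]
    change ∫ y, f y ∂(((P ^ n) ∘ₖ P) x) = _
    rw [Kernel.integral_comp]
    · rfl
    · exact f.integrable _

/-- The Feller property is weak continuity of x ↦ Pⁿ(x, ·); the portmanteau theorem gives the bound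
on open sets. -/
lemma WeakFeller.lowerSemicontinuous [HasOuterApproxClosed X] (h : WeakFeller P) (n : ℕ)
    {G : Set X} (hG : IsOpen G) : LowerSemicontinuous fun x => (P ^ n) x G := by
  refine lowerSemicontinuous_iff_le_liminf.2 fun x => ?_
  let μs : X → ProbabilityMeasure X := fun y => ⟨(P ^ n) y, inferInstance⟩
  have ht : Tendsto μs (𝓝 x) (𝓝 (μs x)) :=
    ProbabilityMeasure.tendsto_iff_forall_integral_tendsto.2 fun f => (h.pow n f).tendsto x
  exact ProbabilityMeasure.le_liminf_measure_open_of_tendsto ht hG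

lemma WeakFeller.isOpen_lt [HasOuterApproxClosed X] (h : WeakFeller P) (n : ℕ)
    {G : Set X} (hG : IsOpen G) (δ : ℝ≥0∞) : IsOpen {x | δ < (P ^ n) x G} :=
  (h.lowerSemicontinuous n hG).isOpen_preimage δ

lemma TopologicallyIrreducible.exists_pow_pos (hirr : TopologicallyIrreducible P) (x : X)
    {G : Set X} (hG : IsOpen G) (hne : G.Nonempty) : ∃ n, 0 < n ∧ 0 < (P ^ n) x G := by
  by_contra! hcon
  refine (hirr x G hG hne).ne' ?_
  have : hits G ⊆ ⋃ n, ⋃ (_ : 0 < n), {ω : ℕ → X | ω n ∈ G} := by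
    rintro ω ⟨n, hn, h⟩
    exact mem_iUnion₂.2 ⟨n, hn, h⟩
  refine measure_mono_null this (measure_iUnion_null fun n => measure_iUnion_null fun hn => ?_)
  rw [pathLaw_apply_mem P n x hG.measurableSet]
  exact le_antisymm (hcon n hn) zero_le

/-- Irreducibility gives n with Pⁿ(x, G) > δ > 0. The set U where this inequality holds is open and
contains x, so it is recurrent, and every visit to U gives probability at least δ of hitting G
later. -/
theorem pathLaw_visitsInfinitely [HasOuterApproxClosed X] (hirr : TopologicallyIrreducible P)
    (hrec : TopologicallyRecurrent P) (hfeller : WeakFeller P) (x : X) {G : Set X} (hG : IsOpen G)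
    (hne : G.Nonempty) : pathLaw P x (visitsInfinitely G) = 1 := by
  obtain ⟨n, hn, hpos⟩ := hirr.exists_pow_pos x hG hne
  obtain ⟨δ, hδ0, hδ⟩ := exists_between hpos
  have hUo := hfeller.isOpen_lt n hG δ
  refine pathLaw_visitsInfinitely_of_le P hG.measurableSet (hrec G hG) hUo.measurableSet
    (hrec _ hUo) hδ0.ne' (fun y hy => ?_) hδ
  refine le_of_lt (lt_of_lt_of_le hy ?_)
  rw [← pathLaw_apply_mem P n y hG.measurableSet]
  exact measure_mono fun ω hω => ⟨n, hn, hω⟩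

/-- By Borel–Cantelli, a finite sum would allow only finitely many visits. -/
lemma tsum_pow_eq_top [HasOuterApproxClosed X] (hirr : TopologicallyIrreducible P)
    (hrec : TopologicallyRecurrent P) (hfeller : WeakFeller P) (x : X) {G : Set X} (hG : IsOpen G)
    (hne : G.Nonempty) : ∑' n, (P ^ n) x G = ∞ := by
  by_contra hfin
  have h : ∑' n, pathLaw P x {ω | ω n ∈ G} ≠ ∞ := by
    simpa only [pathLaw_apply_mem P _ x hG.measurableSet] using hfin
  have h0 := measure_limsup_atTop_eq_zero h
  have e : visitsInfinitely G = limsup (fun k => {ω : ℕ → X | ω k ∈ G}) atTop := by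
    ext ω; rw [mem_limsup_iff_frequently_mem]; rfl
  rw [← e, pathLaw_visitsInfinitely hirr hrec hfeller x hG hne] at h0
  exact one_ne_zero h0

lemma visitsBothSet_eq_univ [HasOuterApproxClosed X] (hirr : TopologicallyIrreducible P)
    (hrec : TopologicallyRecurrent P) (hfeller : WeakFeller P) {A : Set X}
    (h1 : (interior A).Nonempty) (h2 : (interior Aᶜ).Nonempty) : visitsBothSet P A = univ := by
  refine eq_univ_of_forall fun x => ?_
  have hm1 := measurableSet_visitsInfinitely (isOpen_interior (s := A)).measurableSet
  have hm2 := measurableSet_visitsInfinitely (isOpen_interior (s := Aᶜ)).measurableSet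
  have a1 := (prob_compl_eq_zero_iff hm1).2
    (pathLaw_visitsInfinitely hirr hrec hfeller x isOpen_interior h1)
  have a2 := (prob_compl_eq_zero_iff hm2).2
    (pathLaw_visitsInfinitely hirr hrec hfeller x isOpen_interior h2)
  have a3 := measure_union_null a1 a2
  rw [← compl_inter, prob_compl_eq_zero_iff (hm1.inter hm2)] at a3
  refine le_antisymm prob_le_one (a3 ▸ measure_mono ?_)
  rintro ω ⟨hω1, hω2⟩
  exact ⟨hω1.mono fun k hk => interior_subset hk, hω2.mono fun k hk => interior_subset hk⟩

end Feller

/-! ### Killed, jump and Green kernels acting on measures -/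

section Kernels

variable {X : Type*} [MeasurableSpace X] (P : Kernel X X) {A : Set X} (hA : MeasurableSet A)

open Classical in
/-- The transition kernel of the chain killed at its first entrance into `A` from `Aᶜ`. -/
noncomputable def killedKernel : Kernel X X := Kernel.piecewise hA P (P.restrict hA.compl)

open Classical in
/-- The part of the transition kernel corresponding to an entrance into `A` from `Aᶜ`. -/
noncomputable def jumpKernel : Kernel X X := Kernel.piecewise hA 0 (P.restrict hA)

/-- The Green kernel of a sub-Markov kernel. -/
noncomputable def greenKernel (Q : Kernel X X) : Kernel X X := Kernel.sum fun n => Q ^ n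

lemma killedKernel_apply_of_mem {x : X} (hx : x ∈ A) : killedKernel P hA x = P x := by
  simp [killedKernel, Kernel.piecewise_apply, hx]

lemma killedKernel_apply_of_notMem {x : X} (hx : x ∉ A) :
    killedKernel P hA x = (P x).restrict Aᶜ := by
  simp [killedKernel, Kernel.piecewise_apply, hx, Kernel.restrict_apply]

lemma jumpKernel_apply_of_mem {x : X} (hx : x ∈ A) : jumpKernel P hA x = 0 := by
  simp [jumpKernel, Kernel.piecewise_apply, hx]

lemma jumpKernel_apply_of_notMem {x : X} (hx : x ∉ A) :
    jumpKernel P hA x = (P x).restrict A := by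
  simp [jumpKernel, Kernel.piecewise_apply, hx, Kernel.restrict_apply]

lemma jumpKernel_compl (x : X) : jumpKernel P hA x Aᶜ = 0 := by
  by_cases hx : x ∈ A
  · simp [jumpKernel_apply_of_mem P hA hx]
  · simp [jumpKernel_apply_of_notMem P hA hx, Measure.restrict_apply hA.compl]

lemma killedKernel_add_jumpKernel : killedKernel P hA + jumpKernel P hA = P := by
  ext x : 1
  rw [_root_.add_apply]
  by_cases hx : x ∈ A
  · simp [killedKernel_apply_of_mem P hA hx, jumpKernel_apply_of_mem P hA hx]
  · rw [killedKernel_apply_of_notMem P hA hx, jumpKernel_apply_of_notMem P hA hx, add_comm,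
      Measure.restrict_add_restrict_compl hA]

lemma bind_eq_add (m : Measure X) :
    m.bind P = m.bind (killedKernel P hA) + m.bind (jumpKernel P hA) := by
  conv_lhs => rw [← killedKernel_add_jumpKernel P hA]
  exact Measure.add_comp

lemma bind_one (m : Measure X) : m.bind (1 : Kernel X X) = m := Measure.id_comp

lemma bind_mul (Q R : Kernel X X) (m : Measure X) :
    m.bind (R * Q : Kernel X X) = (m.bind Q).bind R :=
  Measure.comp_assoc.symm

lemma bind_greenKernel_apply (Q : Kernel X X) (m : Measure X) {B : Set X} (hB : MeasurableSet B) :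
    m.bind (greenKernel Q) B = ∑' n, m.bind (Q ^ n : Kernel X X) B := by
  rw [Measure.bind_apply hB (Kernel.aemeasurable _)]
  simp_rw [greenKernel, Kernel.sum_apply' _ _ hB, Measure.bind_apply hB (Kernel.aemeasurable _)]
  exact lintegral_tsum fun n => (Kernel.measurable_coe _ hB).aemeasurable

lemma bind_bind_greenKernel_apply (Q R : Kernel X X) (m : Measure X) {B : Set X}
    (hB : MeasurableSet B) :
    (m.bind (greenKernel Q)).bind R B = ∑' n, (m.bind (Q ^ n : Kernel X X)).bind R B := by
  have hR := R.measurable_coe hB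
  have h : ∀ κ : Kernel X X, (m.bind κ).bind R B = ∫⁻ x, ∫⁻ y, R y B ∂(κ x) ∂m := fun κ => by
    rw [Measure.bind_apply hB (Kernel.aemeasurable R),
      Measure.lintegral_bind (Kernel.aemeasurable _) hR.aemeasurable]
  simp_rw [h]
  rw [← lintegral_tsum fun n => (Measurable.lintegral_kernel hR).aemeasurable]
  refine lintegral_congr fun x => ?_
  rw [greenKernel, Kernel.sum_apply, lintegral_sum_measure]

/-- Renewal identity: separate the term n = 0 of the Green series. -/
lemma bind_greenKernel_eq_add (Q : Kernel X X) (m : Measure X) :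
    m.bind (greenKernel Q) = m + (m.bind (greenKernel Q)).bind Q := by
  refine Measure.ext fun B hB => ?_
  rw [Measure.add_apply, bind_bind_greenKernel_apply Q Q m hB, bind_greenKernel_apply Q m hB,
    tsum_eq_zero_add' ENNReal.summable, pow_zero, bind_one]
  congr 1
  exact tsum_congr fun n => by rw [pow_succ', bind_mul]

lemma sum_range_bind_pow_add (Q : Kernel X X) {m n : Measure X} (h : m.bind Q + n = m) (k : ℕ) :
    ∑ i ∈ Finset.range k, n.bind (Q ^ i : Kernel X X) + m.bind (Q ^ k : Kernel X X) = m := by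
  induction k with
  | zero => simp [bind_one]
  | succ k ih =>
    rw [Finset.sum_range_succ, add_assoc, pow_succ, bind_mul]
    have : n.bind (Q ^ k : Kernel X X) + (m.bind Q).bind (Q ^ k : Kernel X X) =
        m.bind (Q ^ k : Kernel X X) := by
      conv_rhs => rw [← h]
      rw [add_comm]
      exact Measure.comp_add.symm
    rw [this, ih]

/-- Iterating m = n + mQ writes m as a partial sum of the series plus the nonnegative remainder mQᵏ,
so no finiteness is needed. -/
lemma bind_greenKernel_le (Q : Kernel X X) {m n : Measure X} (h : m.bind Q + n = m) :
    n.bind (greenKernel Q) ≤ m := by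
  refine Measure.le_iff.2 fun B hB => ?_
  rw [bind_greenKernel_apply Q n hB]
  refine ENNReal.tsum_le_of_sum_range_le fun k => ?_
  conv_rhs => rw [← sum_range_bind_pow_add Q h k]
  simp

lemma bind_mono_left (κ : Kernel X X) {m n : Measure X} (h : m ≤ n) : m.bind κ ≤ n.bind κ := by
  refine Measure.le_iff.2 fun B hB => ?_
  rw [Measure.bind_apply hB (Kernel.aemeasurable _), Measure.bind_apply hB (Kernel.aemeasurable _)]
  exact lintegral_mono' h le_rfl

lemma bind_pow_of_invariant {m : Measure X} (h : m.bind P = m) (n : ℕ) :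
    m.bind (P ^ n : Kernel X X) = m := by
  induction n with
  | zero => rw [pow_zero, bind_one]
  | succ n ih => rw [pow_succ, bind_mul, h, ih]

/-- Subtraction of measures through densities: m has a density at most 1 with respect to n, and r
takes the complementary density. -/
lemma exists_eq_add_of_le {m n : Measure X} [SigmaFinite n] (h : m ≤ n) :
    ∃ r : Measure X, n = m + r := by
  have : SigmaFinite m := Measure.sigmaFinite_of_le n h
  have hm : n.withDensity (m.rnDeriv n) = m :=
    Measure.withDensity_rnDeriv_eq m n (Measure.absolutelyContinuous_of_le h)
  refine ⟨n.withDensity (1 - m.rnDeriv n), ?_⟩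
  conv_rhs => enter [1]; rw [← hm]
  rw [← withDensity_add_left (Measure.measurable_rnDeriv m n)]
  have : m.rnDeriv n + (1 - m.rnDeriv n) =ᵐ[n] 1 := by
    filter_upwards [Measure.rnDeriv_le_one_of_le h] with x hx
    exact add_tsub_cancel_of_le hx
  rw [withDensity_congr_ae this, withDensity_one]

end Kernels

/-! ### Decomposition of paths at the first entrance -/

section EntranceTime

variable {X : Type*} [MeasurableSpace X] {A : Set X}

/-- The event that the first entrance into `A` from `Aᶜ` occurs at time `k + 1`, from a point of
`B₁` to a point of `B₂`. -/
def firstEntrance (A B₁ B₂ : Set X) (k : ℕ) : Set (ℕ → X) :=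
  {ω | (∀ j < k, ¬ (ω j ∉ A ∧ ω (j + 1) ∈ A)) ∧ ω k ∉ A ∧ ω (k + 1) ∈ A ∧ ω k ∈ B₁ ∧
    ω (k + 1) ∈ B₂}

variable {B₁ B₂ : Set X}

omit [MeasurableSpace X] in
lemma firstEntrance_succ (k : ℕ) : firstEntrance A B₁ B₂ (k + 1) =
    {ω | ¬ (ω 0 ∉ A ∧ ω 1 ∈ A)} ∩ shift ⁻¹' firstEntrance A B₁ B₂ k := by
  ext ω
  constructor
  · rintro ⟨h, h'⟩
    exact ⟨h 0 (by lia), fun j hj => h (j + 1) (by lia), h'⟩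
  · rintro ⟨h0, h, h'⟩
    refine ⟨fun j hj => ?_, h'⟩
    cases j with
    | zero => exact h0
    | succ j => exact h j (by lia)

omit [MeasurableSpace X] in
lemma entranceTime_one_of_mem {ω : ℕ → X} {k : ℕ} (h : ω ∈ firstEntrance A B₁ B₂ k) :
    entranceTime A ω 1 = ((k + 1 : ℕ) : ℕ∞) := by
  obtain ⟨h1, h2, h3, -⟩ := h
  -- Since T_0 = 0, the condition T_0 < k + 1 in the definition of T_1 is vacuous.
  have h0 : entranceTime A ω 0 < (k + 1 : ℕ) := by
    change (0 : ℕ∞) < (k + 1 : ℕ)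
    exact_mod_cast Nat.succ_pos k
  refine le_antisymm (iInf₂_le k ⟨h0, h2, h3⟩) (le_iInf₂ fun j hj => ?_)
  have : k ≤ j := by
    by_contra hlt
    exact h1 j (by lia) hj.2
  exact_mod_cast Nat.succ_le_succ this

omit [MeasurableSpace X] in
lemma exists_mem_firstEntrance {ω : ℕ → X} (h : entranceTime A ω 1 < ⊤) :
    ∃ k, ω ∈ firstEntrance A univ univ k := by
  classical
  have hex : ∃ k, ω k ∉ A ∧ ω (k + 1) ∈ A := by
    by_contra! hcon
    refine h.ne (le_antisymm le_top (le_iInf₂ fun j hj => ?_))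
    exact absurd hj.2.2 (hcon j hj.2.1)
  refine ⟨Nat.find hex, fun j hj => Nat.find_min hex hj, (Nat.find_spec hex).1,
    (Nat.find_spec hex).2, mem_univ _, mem_univ _⟩

omit [MeasurableSpace X] in
lemma setOf_entranceTime_lt_top :
    {ω : ℕ → X | entranceTime A ω 1 < ⊤} ∩ (exitPos A 1 ⁻¹' B₁ ∩ entrancePos A 1 ⁻¹' B₂) =
      ⋃ k, firstEntrance A B₁ B₂ k := by
  ext ω
  simp only [mem_inter_iff, mem_ofPred_eq, mem_preimage, mem_iUnion]
  constructor
  · rintro ⟨hT, h1, h2⟩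
    obtain ⟨k, hk⟩ := exists_mem_firstEntrance hT
    have ht := entranceTime_one_of_mem hk
    rw [exitPos, ht] at h1
    rw [entrancePos, ht] at h2
    exact ⟨k, hk.1, hk.2.1, hk.2.2.1, h1, h2⟩
  · rintro ⟨k, hk⟩
    have ht := entranceTime_one_of_mem hk
    rw [exitPos, entrancePos, ht]
    exact ⟨ENat.natCast_lt_top _, hk.2.2.2.1, hk.2.2.2.2⟩

omit [MeasurableSpace X] in
lemma pairwise_disjoint_firstEntrance :
    Pairwise (Function.onFun Disjoint (firstEntrance A B₁ B₂)) := by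
  intro i j hij
  refine Set.disjoint_left.2 fun ω hi hj => hij ?_
  have := (entranceTime_one_of_mem hi).symm.trans (entranceTime_one_of_mem hj)
  exact Nat.succ_injective (by exact_mod_cast this)

lemma measurableSet_firstEntrance (hA : MeasurableSet A) (h₁ : MeasurableSet B₁)
    (h₂ : MeasurableSet B₂) (k : ℕ) : MeasurableSet (firstEntrance A B₁ B₂ k) := by
  have hev : ∀ (n : ℕ) {B : Set X}, MeasurableSet B → MeasurableSet {ω : ℕ → X | ω n ∈ B} :=
    fun n B hB => measurable_pi_apply n hB
  induction k with
  | zero =>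
    have : firstEntrance A B₁ B₂ 0 = {ω | ω 0 ∈ Aᶜ} ∩ ({ω | ω 1 ∈ A} ∩ ({ω | ω 0 ∈ B₁} ∩
        {ω | ω 1 ∈ B₂})) := by
      ext ω; simp [firstEntrance]
    rw [this]
    exact (hev 0 hA.compl).inter ((hev 1 hA).inter ((hev 0 h₁).inter (hev 1 h₂)))
  | succ k ih =>
    rw [firstEntrance_succ]
    exact ((hev 0 hA.compl).inter (hev 1 hA)).compl.inter (measurable_shift ih)

variable (P : Kernel X X) [IsMarkovKernel P]

lemma pathLaw_firstEntrance_zero (hA : MeasurableSet A) (h₁ : MeasurableSet B₁)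
    (h₂ : MeasurableSet B₂) (x : X) :
    pathLaw P x (firstEntrance A B₁ B₂ 0) = B₁.indicator (fun y => jumpKernel P hA y B₂) x := by
  have e : firstEntrance A B₁ B₂ 0 = {ω | ω 0 ∈ B₁ ∩ Aᶜ} ∩ {ω | ω 1 ∈ A ∩ B₂} := by
    ext ω
    simp only [firstEntrance, mem_ofPred_eq, mem_inter_iff, mem_compl_iff]
    constructor
    · rintro ⟨-, h1, h2, h3, h4⟩
      exact ⟨⟨h3, h1⟩, h2, h4⟩
    · rintro ⟨⟨h3, h1⟩, h2, h4⟩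
      exact ⟨by simp, h1, h2, h3, h4⟩
  rw [e, pathLaw_inter_zero P x (h₁.inter hA.compl)]
  by_cases hx1 : x ∈ B₁
  · by_cases hx : x ∈ A
    · rw [indicator_of_notMem (fun h => h.2 hx), indicator_of_mem hx1,
        jumpKernel_apply_of_mem P hA hx]
      rfl
    · rw [indicator_of_mem (mem_inter hx1 hx), indicator_of_mem hx1, jumpKernel_apply_of_notMem P hA hx,
        Measure.restrict_apply h₂, pathLaw_apply_mem P 1 x (hA.inter h₂), pow_one, inter_comm]
  · rw [indicator_of_notMem (fun h => hx1 h.1), indicator_of_notMem hx1]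

/-- A first step out of A is never an entrance, so it is unrestricted; one from Aᶜ must stay in Aᶜ.
This is exactly the killed kernel. -/
lemma pathLaw_firstEntrance_succ (hA : MeasurableSet A) (h₁ : MeasurableSet B₁)
    (h₂ : MeasurableSet B₂) (k : ℕ) (x : X) :
    pathLaw P x (firstEntrance A B₁ B₂ (k + 1)) =
      ∫⁻ y, pathLaw P y (firstEntrance A B₁ B₂ k) ∂(killedKernel P hA x) := by
  have hm := measurableSet_firstEntrance hA h₁ h₂ k
  rw [firstEntrance_succ]
  by_cases hx : x ∈ A
  · rw [killedKernel_apply_of_mem P hA hx, ← pathLaw_preimage_shift P x hm]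
    refine measure_congr ?_
    filter_upwards [pathLaw_zero_mem_ae P x hA] with ω hω
    exact propext ⟨fun h => h.2, fun h => ⟨fun h' => h'.1 (hω.2 hx), h⟩⟩
  · rw [killedKernel_apply_of_notMem P hA hx, ← lintegral_indicator hA.compl]
    simp_rw [← pathLaw_inter_zero P _ hA.compl]
    have h0 : MeasurableSet {ω : ℕ → X | ω 0 ∈ Aᶜ} := measurable_pi_apply 0 hA.compl
    rw [← pathLaw_preimage_shift P x (h0.inter hm)]
    refine measure_congr ?_
    filter_upwards [pathLaw_zero_mem_ae P x hA] with ω hω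
    exact propext ⟨fun h => ⟨fun h' => h.1 ⟨fun h0 => hx (hω.1 h0), h'⟩, h.2⟩,
      fun h => ⟨fun h' => h.1 h'.2, h.2⟩⟩

lemma pathLaw_firstEntrance (hA : MeasurableSet A) (h₁ : MeasurableSet B₁)
    (h₂ : MeasurableSet B₂) (k : ℕ) (x : X) :
    pathLaw P x (firstEntrance A B₁ B₂ k) =
      ∫⁻ y in B₁, jumpKernel P hA y B₂ ∂((killedKernel P hA ^ k) x) := by
  have hm : Measurable (B₁.indicator fun y => jumpKernel P hA y B₂) :=
    (Kernel.measurable_coe _ h₂).indicator h₁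
  rw [← lintegral_indicator h₁]
  induction k generalizing x with
  | zero =>
    rw [pow_zero, pathLaw_firstEntrance_zero P hA h₁ h₂]
    change _ = ∫⁻ y, _ ∂(Kernel.id x)
    rw [Kernel.id_apply, lintegral_dirac' _ hm]
  | succ k ih =>
    rw [pathLaw_firstEntrance_succ P hA h₁ h₂, lintegral_pow_succ _ _ _ hm]
    exact lintegral_congr ih

/-- The joint law of the first exit position and the first entrance position. -/
theorem pathLaw_entrance (hA : MeasurableSet A) (h₁ : MeasurableSet B₁)
    (h₂ : MeasurableSet B₂) (x : X) :
    pathLaw P x ({ω : ℕ → X | entranceTime A ω 1 < ⊤} ∩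
        (exitPos A 1 ⁻¹' B₁ ∩ entrancePos A 1 ⁻¹' B₂)) =
      ∫⁻ y in B₁, jumpKernel P hA y B₂ ∂(greenKernel (killedKernel P hA) x) := by
  rw [setOf_entranceTime_lt_top, measure_iUnion pairwise_disjoint_firstEntrance
    (measurableSet_firstEntrance hA h₁ h₂), ← lintegral_indicator h₁, greenKernel,
    Kernel.sum_apply, lintegral_sum_measure]
  refine tsum_congr fun k => ?_
  rw [pathLaw_firstEntrance P hA h₁ h₂, lintegral_indicator h₁]

end EntranceTime

/-! ### Transfer between measures on a subset and on the whole space -/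

section Subtype

variable {X : Type*} [MeasurableSpace X] {S : Set X}

lemma map_bind_subtype (hS : MeasurableSet S) (κ : Kernel X X) (hκ : ∀ x, κ x Sᶜ = 0)
    (N : Measure S) :
    (N.bind ((κ.comapRight (MeasurableEmbedding.subtype_coe hS)).comap
      Subtype.val measurable_subtype_coe)).map Subtype.val = (N.map Subtype.val).bind κ := by
  ext B hB
  rw [Measure.map_apply measurable_subtype_coe hB,
    Measure.bind_apply (measurable_subtype_coe hB) (Kernel.aemeasurable _),
    Measure.bind_apply hB (Kernel.aemeasurable _),
    lintegral_map (κ.measurable_coe hB) measurable_subtype_coe]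
  refine lintegral_congr fun x => ?_
  rw [Kernel.comap_apply, Kernel.comapRight_apply' _ _ _ (measurable_subtype_coe hB),
    Subtype.image_preimage_coe, inter_comm]
  exact measure_inter_conull (hκ x)

lemma map_subtype_injective (hS : MeasurableSet S) {N N' : Measure S}
    (h : N.map Subtype.val = N'.map Subtype.val) : N = N' := by
  rw [← (MeasurableEmbedding.subtype_coe hS).comap_map N, h,
    (MeasurableEmbedding.subtype_coe hS).comap_map]

lemma invariant_subtype_iff (hS : MeasurableSet S) (κ : Kernel X X) (hκ : ∀ x, κ x Sᶜ = 0)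
    (N : Measure S) :
    ((κ.comapRight (MeasurableEmbedding.subtype_coe hS)).comap
      Subtype.val measurable_subtype_coe).Invariant N ↔
      (N.map Subtype.val).bind κ = N.map Subtype.val := by
  rw [← map_bind_subtype hS κ hκ N]
  exact ⟨fun h => congrArg _ h, fun h => map_subtype_injective hS h⟩

lemma map_comap_subtype (hS : MeasurableSet S) {μ : Measure X} (hμ : μ Sᶜ = 0) :
    (μ.comap (Subtype.val : S → X)).map Subtype.val = μ := by
  rw [(MeasurableEmbedding.subtype_coe hS).map_comap, Subtype.range_coe]
  exact Measure.restrict_eq_self_of_ae_mem hμ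

lemma isLocallyFiniteMeasure_of_map_le [TopologicalSpace X] [OpensMeasurableSpace X]
    {μ : Measure X} [IsLocallyFiniteMeasure μ] {N : Measure S} (h : N.map Subtype.val ≤ μ) :
    IsLocallyFiniteMeasure N := by
  refine ⟨fun x => ?_⟩
  obtain ⟨U, hxU, hU, hfin⟩ := μ.exists_isOpen_measure_lt_top x
  refine ⟨Subtype.val ⁻¹' U, (hU.preimage continuous_subtype_val).mem_nhds hxU, ?_⟩
  rw [← Measure.map_apply measurable_subtype_coe hU.measurableSet]
  exact (h U).trans_lt hfin

lemma exists_isOpen_map_lt_top [TopologicalSpace X] [OpensMeasurableSpace X] (N : Measure S)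
    [IsLocallyFiniteMeasure N] (x : S) :
    ∃ U : Set X, (x : X) ∈ U ∧ IsOpen U ∧ N.map Subtype.val U < ∞ := by
  obtain ⟨V, hxV, hV, hfin⟩ := N.exists_isOpen_measure_lt_top x
  obtain ⟨U, hU, rfl⟩ := isOpen_induced_iff.1 hV
  refine ⟨U, hxV, hU, ?_⟩
  rwa [Measure.map_apply measurable_subtype_coe hU.measurableSet]

end Subtype

/-! ### Recovering invariant measures; local finiteness -/

section Core

variable {X : Type*} [TopologicalSpace X] [MeasurableSpace X] [OpensMeasurableSpace X]
  [HasOuterApproxClosed X] {P : Kernel X X} [IsMarkovKernel P]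

/-- Excessive locally finite measures are invariant. -/
lemma eq_zero_of_bind_add_eq (hirr : TopologicallyIrreducible P) (hrec : TopologicallyRecurrent P)
    (hfeller : WeakFeller P) {m η : Measure X} [IsLocallyFiniteMeasure m]
    (h : m.bind P + η = m) : η = 0 := by
  by_contra hη
  have : Nonempty X := by
    by_contra hX
    rw [not_nonempty_iff] at hX
    exact hη (Subsingleton.elim _ _)
  obtain ⟨x⟩ := this
  obtain ⟨U, hxU, hU, hfin⟩ := m.exists_isOpen_measure_lt_top x
  -- Here the Green kernel is that of P itself, infinite on U from every point, so a nonzero η would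
  -- give m U = ∞.
  have hle := bind_greenKernel_le P h U
  rw [Measure.bind_apply hU.measurableSet (Kernel.aemeasurable _)] at hle
  have htop : ∀ y, greenKernel P y U = ∞ := fun y => by
    rw [greenKernel, Kernel.sum_apply' _ _ hU.measurableSet]
    exact tsum_pow_eq_top hirr hrec hfeller y hU ⟨x, hxU⟩
  simp_rw [htop] at hle
  rw [lintegral_const, ENNReal.top_mul (by simpa using hη)] at hle
  exact absurd hfin (not_lt.2 hle)

/-- Around x take {Pⁿ(·, U) > δ}, open by the Feller property. Chebyshev's inequality in μ U = ∫
Pⁿ(y, U) μ(dy) bounds its mass by μ U / δ. -/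
lemma isLocallyFiniteMeasure_of_invariant (hirr : TopologicallyIrreducible P)
    (hfeller : WeakFeller P) {μ : Measure X} (h : μ.bind P = μ) {U : Set X} (hU : IsOpen U)
    (hne : U.Nonempty) (hfin : μ U < ∞) : IsLocallyFiniteMeasure μ := by
  refine ⟨fun x => ?_⟩
  obtain ⟨n, -, hpos⟩ := hirr.exists_pow_pos x hU hne
  obtain ⟨δ, hδ0, hδ⟩ := exists_between hpos
  have hV := hfeller.isOpen_lt n hU δ
  refine ⟨_, hV.mem_nhds hδ, ?_⟩
  have h1 : δ * μ {y | δ < (P ^ n) y U} ≤ μ U := by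
    conv_rhs => rw [← bind_pow_of_invariant P h n]
    rw [Measure.bind_apply hU.measurableSet (Kernel.aemeasurable _),
      ← setLIntegral_const]
    refine (setLIntegral_mono' hV.measurableSet fun y hy => le_of_lt hy).trans ?_
    exact setLIntegral_le_lintegral _ _
  by_contra htop
  rw [not_lt, top_le_iff] at htop
  rw [htop, ENNReal.mul_top hδ0.ne'] at h1
  exact absurd hfin (not_lt.2 h1)

variable {A : Set X} (hA : MeasurableSet A)

/-- The points of the interior of Aᶜ with positive probability of stepping into the interior of A
form a non-empty open set, which irreducibility reaches. -/
lemma exists_pow_jump_pos (hirr : TopologicallyIrreducible P) (hfeller : WeakFeller P)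
    (hjump : ∃ x ∈ interior Aᶜ, 0 < P x (interior A)) (x : X) :
    ∃ n, ∫⁻ y, jumpKernel P hA y univ ∂((P ^ n) x) ≠ 0 := by
  obtain ⟨x₀, hx₀, hpos⟩ := hjump
  have hV := hfeller.isOpen_lt 1 (isOpen_interior (s := A)) 0
  rw [pow_one] at hV
  obtain ⟨n, -, hn⟩ := hirr.exists_pow_pos x (hV.inter (isOpen_interior (s := Aᶜ)))
    ⟨x₀, hpos, hx₀⟩
  refine ⟨n, fun h0 => hn.ne' ?_⟩
  rw [lintegral_eq_zero_iff (Kernel.measurable_coe _ .univ)] at h0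
  refine measure_mono_null ?_ (ae_iff.1 h0)
  rintro y ⟨hy1, hy2⟩
  have hyA : y ∉ A := interior_subset hy2
  change jumpKernel P hA y univ ≠ 0
  rw [jumpKernel_apply_of_notMem P hA hyA, Measure.restrict_apply_univ]
  exact (lt_of_lt_of_le hy1 (measure_mono interior_subset)).ne'

/-- An invariant measure is recovered from its entrance measure. -/
theorem bind_jumpKernel_bind_greenKernel [SecondCountableTopology X]
    (hirr : TopologicallyIrreducible P) (hrec : TopologicallyRecurrent P)
    (hfeller : WeakFeller P) (hjump : ∃ x ∈ interior Aᶜ, 0 < P x (interior A))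
    {μ : Measure X} [IsLocallyFiniteMeasure μ] (hμ : μ.bind P = μ) :
    (μ.bind (jumpKernel P hA)).bind (greenKernel (killedKernel P hA)) = μ := by
  set Q := killedKernel P hA
  set R := jumpKernel P hA
  set ν := μ.bind R with hν
  set μ' := ν.bind (greenKernel Q) with hμ'
  have hdec : μ.bind Q + ν = μ := (bind_eq_add P hA μ).symm.trans hμ
  have hle : μ' ≤ μ := bind_greenKernel_le Q hdec
  have hνle : ν ≤ μ := hdec ▸ Measure.le_add_left le_rfl
  have : SigmaFinite ν := Measure.sigmaFinite_of_le μ hνle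
  have : SigmaFinite μ' := Measure.sigmaFinite_of_le μ hle
  have : IsLocallyFiniteMeasure μ' := Measure.isLocallyFiniteMeasure_of_le hle
  have hKle : μ'.bind R ≤ ν := bind_mono_left R hle
  have : SigmaFinite (μ'.bind R) := Measure.sigmaFinite_of_le ν hKle
  obtain ⟨η, hη⟩ := exists_eq_add_of_le hKle
  have hren : μ' = ν + μ'.bind Q := bind_greenKernel_eq_add Q ν
  -- Add μ'R to both sides and cancel it afterwards; cancellation is legitimate because μ'R is
  -- σ-finite.
  have hexc : μ'.bind P + η = μ' := by
    rw [← Measure.add_right_inj (μ'.bind R)]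
    calc μ'.bind R + (μ'.bind P + η) = μ'.bind P + (μ'.bind R + η) := add_left_comm _ _ _
      _ = μ'.bind Q + μ'.bind R + ν := by rw [← hη, bind_eq_add P hA]
      _ = μ'.bind R + (ν + μ'.bind Q) := by abel
      _ = μ'.bind R + μ' := by rw [← hren]
  have hη0 := eq_zero_of_bind_add_eq hirr hrec hfeller hexc
  rw [hη0, add_zero] at hη hexc
  obtain ⟨ρ, hρ⟩ := exists_eq_add_of_le hle
  have hρP : ρ.bind P = ρ := by
    rw [← Measure.add_right_inj μ']
    calc μ' + ρ.bind P = μ'.bind P + ρ.bind P := by rw [hexc]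
      _ = (μ' + ρ).bind P := Measure.comp_add.symm
      _ = μ' + ρ := by rw [← hρ, hμ]
  have hρR : ρ.bind R = 0 := by
    rw [← Measure.add_right_inj (μ'.bind R)]
    calc μ'.bind R + ρ.bind R = (μ' + ρ).bind R := Measure.comp_add.symm
      _ = μ'.bind R + 0 := by rw [← hρ, ← hν, hη, add_zero]
  -- Invariance gives ρPⁿR = ρR = 0 for all n, so ρ-almost every point would never make a jump into
  -- A.
  have hρ0 : ρ = 0 := by
    have hae : ∀ n, ∀ᵐ x ∂ρ, ∫⁻ y, R y univ ∂((P ^ n) x) = 0 := by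
      intro n
      have hR := R.measurable_coe MeasurableSet.univ
      refine (lintegral_eq_zero_iff hR.lintegral_kernel).1 ?_
      rw [← Measure.lintegral_bind (Kernel.aemeasurable _) hR.aemeasurable,
        bind_pow_of_invariant P hρP, ← Measure.bind_apply .univ (Kernel.aemeasurable _), hρR]
      rfl
    refine ae_eq_bot.1 (eventually_false_iff_eq_bot.1 ?_)
    filter_upwards [ae_all_iff.2 hae] with x hx
    obtain ⟨n, hn⟩ := exists_pow_jump_pos hA hirr hfeller hjump x
    exact hn (hx n)
  rw [hρ, hρ0, add_zero]

omit [TopologicalSpace X] [OpensMeasurableSpace X] [HasOuterApproxClosed X] [IsMarkovKernel P] in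
/-- The measure built from an invariant measure of the entrance chain is invariant. -/
lemma bind_greenKernel_invariant {ν : Measure X}
    (hν : (ν.bind (greenKernel (killedKernel P hA))).bind (jumpKernel P hA) = ν) :
    (ν.bind (greenKernel (killedKernel P hA))).bind P = ν.bind (greenKernel (killedKernel P hA)) := by
  rw [bind_eq_add P hA, hν, add_comm]
  exact (bind_greenKernel_eq_add _ ν).symm

/-- N is finite on small open pieces W of the interior of A, and some W has P(x₀, W) > 0, since
otherwise P(x₀, ·) would be locally null there. Near x₀ each point sends mass at least δ into W, so
μ is finite there. -/
lemma isLocallyFiniteMeasure_of_bind_jumpKernel [SecondCountableTopology X]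
    (hirr : TopologicallyIrreducible P)
    (hfeller : WeakFeller P) (hjump : ∃ x ∈ interior Aᶜ, 0 < P x (interior A))
    {μ : Measure X} (hμ : μ.bind P = μ) {N : Measure A} [IsLocallyFiniteMeasure N]
    (hN : μ.bind (jumpKernel P hA) = N.map Subtype.val) : IsLocallyFiniteMeasure μ := by
  obtain ⟨x₀, hx₀, hpos⟩ := hjump
  obtain ⟨W, hW, hWA, hWfin, hWpos⟩ : ∃ W : Set X, IsOpen W ∧ W ⊆ A ∧
      N.map Subtype.val W < ∞ ∧ 0 < P x₀ W := by
    by_contra! hcon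
    refine hpos.ne' (measure_null_of_locally_null _ fun a ha => ?_)
    obtain ⟨U, haU, hU, hUfin⟩ := exists_isOpen_map_lt_top N ⟨a, interior_subset ha⟩
    refine ⟨U ∩ interior A,
      mem_nhdsWithin_of_mem_nhds ((hU.inter isOpen_interior).mem_nhds ⟨haU, ha⟩), ?_⟩
    exact le_antisymm (hcon _ (hU.inter isOpen_interior)
      (inter_subset_right.trans interior_subset)
      ((measure_mono inter_subset_left).trans_lt hUfin)) zero_le
  obtain ⟨δ, hδ0, hδ⟩ := exists_between hWpos
  have hV := hfeller.isOpen_lt 1 hW δ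
  rw [pow_one] at hV
  have hV' := hV.inter (isOpen_interior (s := Aᶜ))
  refine isLocallyFiniteMeasure_of_invariant hirr hfeller hμ hV' ⟨x₀, hδ, hx₀⟩ ?_
  have h1 : δ * μ ({y | δ < P y W} ∩ interior Aᶜ) ≤ N.map Subtype.val W := by
    rw [← hN, Measure.bind_apply hW.measurableSet (Kernel.aemeasurable _), ← setLIntegral_const]
    refine (setLIntegral_mono' hV'.measurableSet fun y hy => ?_).trans
      (setLIntegral_le_lintegral _ _)
    rw [jumpKernel_apply_of_notMem P hA (interior_subset hy.2),
      Measure.restrict_apply hW.measurableSet, inter_eq_left.2 hWA]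
    exact le_of_lt hy.1
  by_contra htop
  rw [not_lt, top_le_iff] at htop
  rw [htop, ENNReal.mul_top hδ0.ne'] at h1
  exact absurd hWfin (not_lt.2 h1)

/-- Near x₀ the density of the exit measure exceeds δ, so finiteness of N there passes to μ. -/
lemma isLocallyFiniteMeasure_of_withDensity (hirr : TopologicallyIrreducible P)
    (hfeller : WeakFeller P) (hjump : ∃ x ∈ interior Aᶜ, 0 < P x (interior A))
    {μ : Measure X} (hμ : μ.bind P = μ) {N : Measure (Aᶜ : Set X)} [IsLocallyFiniteMeasure N]
    (hN : μ.withDensity (fun x => jumpKernel P hA x univ) = N.map Subtype.val) :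
    IsLocallyFiniteMeasure μ := by
  obtain ⟨x₀, hx₀, hpos⟩ := hjump
  obtain ⟨W, hxW, hW, hWfin⟩ := exists_isOpen_map_lt_top N ⟨x₀, interior_subset hx₀⟩
  obtain ⟨δ, hδ0, hδ⟩ := exists_between hpos
  have hV := hfeller.isOpen_lt 1 (isOpen_interior (s := A)) δ
  rw [pow_one] at hV
  have hV' := (hV.inter (isOpen_interior (s := Aᶜ))).inter hW
  refine isLocallyFiniteMeasure_of_invariant hirr hfeller hμ hV' ⟨x₀, ⟨hδ, hx₀⟩, hxW⟩ ?_
  have h1 : δ * μ ({y | δ < P y (interior A)} ∩ interior Aᶜ ∩ W) ≤ N.map Subtype.val W := by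
    refine le_trans ?_ (measure_mono (μ := N.map Subtype.val)
      (inter_subset_right (s := {y | δ < P y (interior A)} ∩ interior Aᶜ)))
    rw [← hN, withDensity_apply _ hV'.measurableSet, ← setLIntegral_const]
    refine setLIntegral_mono' hV'.measurableSet fun y hy => ?_
    rw [jumpKernel_apply_of_notMem P hA (interior_subset hy.1.2), Measure.restrict_apply_univ]
    exact (le_of_lt hy.1.1).trans (measure_mono interior_subset)
  by_contra htop
  rw [not_lt, top_le_iff] at htop
  rw [htop, ENNReal.mul_top hδ0.ne'] at h1
  exact absurd hWfin (not_lt.2 h1)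

end Core

/-! ### The entrance and exit chains in terms of the kernels -/

section Chains

variable {X : Type*} [MeasurableSpace X] (P : Kernel X X) [IsMarkovKernel P] {A : Set X}
  (hA : MeasurableSet A)

lemma map_entrancePos_eq :
    ((pathLaw P).restrict (measurableSet_entranceTime_lt_top hA 1)).map (entrancePos A 1) =
      jumpKernel P hA ∘ₖ greenKernel (killedKernel P hA) := by
  ext x B hB
  rw [Kernel.map_apply' _ (measurable_entrancePos hA 1) _ hB,
    Kernel.restrict_apply' _ _ _ (measurable_entrancePos hA 1 hB),
    Kernel.comp_apply' _ _ _ hB]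
  have := pathLaw_entrance P hA .univ hB x
  rw [Measure.restrict_univ, preimage_univ, univ_inter] at this
  rw [← this, inter_comm]

lemma map_exitPos_apply (x : X) :
    ((pathLaw P).restrict (measurableSet_entranceTime_lt_top hA 1)).map (exitPos A 1) x =
      (greenKernel (killedKernel P hA) x).withDensity fun y => jumpKernel P hA y univ := by
  ext B hB
  rw [Kernel.map_apply' _ (measurable_exitPos hA 1) _ hB,
    Kernel.restrict_apply' _ _ _ (measurable_exitPos hA 1 hB), withDensity_apply _ hB,
    ← pathLaw_entrance P hA hB .univ x, preimage_univ, inter_univ, inter_comm]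

lemma bind_map_exitPos (ν : Measure X) :
    ν.bind (((pathLaw P).restrict (measurableSet_entranceTime_lt_top hA 1)).map (exitPos A 1)) =
      (ν.bind (greenKernel (killedKernel P hA))).withDensity fun y => jumpKernel P hA y univ := by
  ext B hB
  have hR := (jumpKernel P hA).measurable_coe MeasurableSet.univ
  rw [Measure.bind_apply hB (Kernel.aemeasurable _), withDensity_apply _ hB,
    ← lintegral_indicator hB, Measure.lintegral_bind (Kernel.aemeasurable _)
      (hR.indicator hB).aemeasurable]
  refine lintegral_congr fun x => ?_
  rw [map_exitPos_apply, withDensity_apply _ hB, lintegral_indicator hB]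

/-- The density P(x, A) on Aᶜ cancels the normalisation of the conditional law; where it vanishes,
both sides are zero. -/
lemma withDensity_bind_condKernel (μ : Measure X) :
    (μ.withDensity fun y => jumpKernel P hA y univ).bind (condKernel P A hA) =
      μ.bind (jumpKernel P hA) := by
  ext B hB
  have hR := (jumpKernel P hA).measurable_coe MeasurableSet.univ
  rw [Measure.bind_apply hB (Kernel.aemeasurable _), Measure.bind_apply hB (Kernel.aemeasurable _),
    lintegral_withDensity_eq_lintegral_mul _ hR (Kernel.measurable_coe _ hB)]
  refine lintegral_congr fun x => ?_
  change jumpKernel P hA x univ * cond (P x) A B = _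
  by_cases hx : x ∈ A
  · simp [jumpKernel_apply_of_mem P hA hx]
  · rw [jumpKernel_apply_of_notMem P hA hx, Measure.restrict_apply_univ, mul_comm,
      cond_mul_eq_inter hA, Measure.restrict_apply hB, inter_comm]

omit [IsMarkovKernel P] in
lemma withDensity_jumpKernel_apply_compl (μ : Measure X) :
    (μ.withDensity fun y => jumpKernel P hA y univ) Aᶜᶜ = 0 := by
  rw [compl_compl, withDensity_apply _ hA, setLIntegral_congr_fun hA
    (g := fun _ => 0) (fun x hx => by simp [jumpKernel_apply_of_mem P hA hx]), lintegral_zero]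

lemma exitKernel_apply_compl (x : X) :
    ((((pathLaw P).restrict (measurableSet_entranceTime_lt_top hA 1)).map (exitPos A 1)).comp
      (condKernel P A hA)) x Aᶜᶜ = 0 := by
  rw [Kernel.comp_apply, bind_map_exitPos]
  exact withDensity_jumpKernel_apply_compl P hA _

omit [IsMarkovKernel P] in
lemma bind_jumpKernel_compl (m : Measure X) : m.bind (jumpKernel P hA) Aᶜ = 0 := by
  rw [Measure.bind_apply hA.compl (Kernel.aemeasurable _)]
  simp [jumpKernel_compl]

omit [IsMarkovKernel P] in
lemma entranceMeasure_eq (μ : Measure X) :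
    entranceMeasure P A μ = (μ.bind (jumpKernel P hA)).comap Subtype.val := by
  ext B hB
  have hB' := (MeasurableEmbedding.subtype_coe hA).measurableSet_image.2 hB
  rw [entranceMeasure, (MeasurableEmbedding.subtype_coe hA).comap_apply,
    (MeasurableEmbedding.subtype_coe hA).comap_apply,
    Measure.bind_apply hB' (Kernel.aemeasurable _), Measure.bind_apply hB' (Kernel.aemeasurable _),
    ← lintegral_indicator hA.compl]
  refine lintegral_congr fun x => ?_
  by_cases hx : x ∈ A
  · rw [indicator_of_notMem (notMem_compl_iff.2 hx), jumpKernel_apply_of_mem P hA hx]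
    rfl
  · rw [indicator_of_mem (mem_compl hx), jumpKernel_apply_of_notMem P hA hx, Measure.restrict_apply hB',
      inter_eq_left.2 (Subtype.coe_image_subset A B)]

omit [IsMarkovKernel P] in
lemma exitMeasure_eq (μ : Measure X) :
    exitMeasure P A μ = (μ.withDensity fun y => jumpKernel P hA y univ).comap Subtype.val := by
  ext B hB
  have hB' := (MeasurableEmbedding.subtype_coe hA.compl).measurableSet_image.2 hB
  rw [exitMeasure, (MeasurableEmbedding.subtype_coe hA.compl).comap_apply,
    (MeasurableEmbedding.subtype_coe hA.compl).comap_apply,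
    withDensity_apply _ hB', withDensity_apply _ hB']
  refine setLIntegral_congr_fun hB' fun x hx => ?_
  have hx' : x ∉ A := Subtype.coe_image_subset Aᶜ B hx
  change P x A = jumpKernel P hA x univ
  rw [jumpKernel_apply_of_notMem P hA hx', Measure.restrict_apply_univ]

omit [IsMarkovKernel P] in
lemma map_entranceMeasure (μ : Measure X) :
    (entranceMeasure P A μ).map Subtype.val = μ.bind (jumpKernel P hA) := by
  rw [entranceMeasure_eq P hA, map_comap_subtype hA (bind_jumpKernel_compl P hA μ)]

omit [IsMarkovKernel P] in
lemma map_exitMeasure (μ : Measure X) :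
    (exitMeasure P A μ).map Subtype.val = μ.withDensity fun y => jumpKernel P hA y univ := by
  rw [exitMeasure_eq P hA, map_comap_subtype hA.compl (withDensity_jumpKernel_apply_compl P hA μ)]

lemma invariant_entranceKernel_iff (N : Measure A) :
    (entranceKernel P A hA).Invariant N ↔
      ((N.map Subtype.val).bind (greenKernel (killedKernel P hA))).bind (jumpKernel P hA) =
        N.map Subtype.val := by
  rw [entranceKernel, map_entrancePos_eq, invariant_subtype_iff hA, Measure.comp_assoc]
  intro x
  rw [Kernel.comp_apply]
  exact bind_jumpKernel_compl P hA _

lemma invariant_exitKernel_iff (N : Measure (Aᶜ : Set X)) :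
    (exitKernel P A hA).Invariant N ↔
      (((N.map Subtype.val).bind (condKernel P A hA)).bind
        (greenKernel (killedKernel P hA))).withDensity (fun y => jumpKernel P hA y univ) =
        N.map Subtype.val := by
  rw [exitKernel, invariant_subtype_iff hA.compl _ (exitKernel_apply_compl P hA),
    ← Measure.comp_assoc, bind_map_exitPos]

end Chains

/-! ### The two bijections -/

section Bijections

variable {X : Type*} [TopologicalSpace X] [MeasurableSpace X] [OpensMeasurableSpace X]
  [HasOuterApproxClosed X] [SecondCountableTopology X] {P : Kernel X X} [IsMarkovKernel P]
  {A : Set X} (hA : MeasurableSet A)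

/-- The inverse map applies the Green kernel of the killed chain to N. -/
theorem bijOn_entranceMeasure (hirr : TopologicallyIrreducible P)
    (hrec : TopologicallyRecurrent P) (hfeller : WeakFeller P)
    (hjump : ∃ x ∈ interior Aᶜ, 0 < P x (interior A)) :
    BijOn (entranceMeasure P A) (locallyFiniteInvariant P)
      (locallyFiniteInvariant (entranceKernel P A hA)) := by
  have hrecov : ∀ μ ∈ locallyFiniteInvariant P,
      ((entranceMeasure P A μ).map Subtype.val).bind (greenKernel (killedKernel P hA)) = μ := by
    rintro μ ⟨hfin, hinv⟩
    rw [map_entranceMeasure P hA]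
    exact bind_jumpKernel_bind_greenKernel hA hirr hrec hfeller hjump hinv
  refine ⟨?_, ?_, ?_⟩
  · intro μ hμ
    have hfin := hμ.1
    refine ⟨isLocallyFiniteMeasure_of_map_le (μ := μ) ?_, ?_⟩
    · rw [map_entranceMeasure P hA]
      conv_rhs => rw [← hμ.2.def, bind_eq_add P hA]
      exact Measure.le_add_left le_rfl
    · rw [invariant_entranceKernel_iff, hrecov μ hμ, map_entranceMeasure P hA]
  · intro μ₁ h₁ μ₂ h₂ h
    rw [← hrecov μ₁ h₁, h, hrecov μ₂ h₂]
  · rintro N ⟨hfin, hinv⟩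
    rw [invariant_entranceKernel_iff] at hinv
    have hμ := bind_greenKernel_invariant hA hinv
    refine ⟨_, ⟨isLocallyFiniteMeasure_of_bind_jumpKernel hA hirr hfeller hjump hμ hinv, hμ⟩, ?_⟩
    refine map_subtype_injective hA ?_
    rw [map_entranceMeasure P hA, hinv]

/-- The inverse first takes a step conditioned to land in A, which produces the entrance measure,
and then applies the Green kernel. -/
theorem bijOn_exitMeasure (hirr : TopologicallyIrreducible P)
    (hrec : TopologicallyRecurrent P) (hfeller : WeakFeller P)
    (hjump : ∃ x ∈ interior Aᶜ, 0 < P x (interior A)) :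
    BijOn (exitMeasure P A) (locallyFiniteInvariant P)
      (locallyFiniteInvariant (exitKernel P A hA)) := by
  have hrecov : ∀ μ ∈ locallyFiniteInvariant P,
      (((exitMeasure P A μ).map Subtype.val).bind (condKernel P A hA)).bind
        (greenKernel (killedKernel P hA)) = μ := by
    rintro μ ⟨hfin, hinv⟩
    rw [map_exitMeasure P hA, withDensity_bind_condKernel P hA]
    exact bind_jumpKernel_bind_greenKernel hA hirr hrec hfeller hjump hinv
  refine ⟨?_, ?_, ?_⟩
  · intro μ hμ
    have hfin := hμ.1
    refine ⟨isLocallyFiniteMeasure_of_map_le (μ := μ) ?_, ?_⟩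
    · rw [map_exitMeasure P hA]
      conv_rhs => rw [← withDensity_one (μ := μ)]
      refine withDensity_mono (ae_of_all _ fun x => ?_)
      by_cases hx : x ∈ A
      · simp [jumpKernel_apply_of_mem P hA hx]
      · change jumpKernel P hA x univ ≤ 1
        rw [jumpKernel_apply_of_notMem P hA hx, Measure.restrict_apply_univ]
        exact prob_le_one
    · rw [invariant_exitKernel_iff, hrecov μ hμ, map_exitMeasure P hA]
  · intro μ₁ h₁ μ₂ h₂ h
    rw [← hrecov μ₁ h₁, h, hrecov μ₂ h₂]
  · rintro N ⟨hfin, hinv⟩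
    rw [invariant_exitKernel_iff] at hinv
    -- Applying the conditional step to the invariance equation of N shows that its image is
    -- invariant for the entrance chain.
    have hν : (((N.map Subtype.val).bind (condKernel P A hA)).bind
        (greenKernel (killedKernel P hA))).bind (jumpKernel P hA) =
        (N.map Subtype.val).bind (condKernel P A hA) := by
      rw [← withDensity_bind_condKernel P hA, hinv]
    have hμ := bind_greenKernel_invariant hA hν
    refine ⟨_, ⟨isLocallyFiniteMeasure_of_withDensity hA hirr hfeller hjump hμ hinv, hμ⟩, ?_⟩
    refine map_subtype_injective hA.compl ?_
    rw [map_exitMeasure P hA, hinv]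

end Bijections

end EntranceExit

open EntranceExit in
theorem theorem3p3 {X : Type*} [MetricSpace X] [TopologicalSpace.SeparableSpace X]
    [MeasurableSpace X] [BorelSpace X]
    (P : Kernel X X) [IsMarkovKernel P]
    (hirr : TopologicallyIrreducible P) (hrec : TopologicallyRecurrent P)
    (hfeller : WeakFeller P)
    (A : Set X) (hA : MeasurableSet A)
    (hjump : ∃ x ∈ interior Aᶜ, 0 < P x (interior A)) :
    (BijOn (entranceMeasure P A) (locallyFiniteInvariant P)
        (locallyFiniteInvariant (entranceKernel P A hA)) ∧
      ∀ ν ∈ locallyFiniteInvariant (entranceKernel P A hA), ProperEntrance P A ν) ∧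
    (BijOn (exitMeasure P A) (locallyFiniteInvariant P)
        (locallyFiniteInvariant (exitKernel P A hA)) ∧
      ∀ ν ∈ locallyFiniteInvariant (exitKernel P A hA), ProperExit P A ν) := by
  have : SecondCountableTopology X := UniformSpace.secondCountable_of_separable X
  have hexit := bijOn_exitMeasure hA hirr hrec hfeller hjump
  have huniv : visitsBothSet P A = univ := by
    obtain ⟨x, hx, hpos⟩ := hjump
    exact visitsBothSet_eq_univ hirr hrec hfeller
      (nonempty_of_measure_ne_zero hpos.ne') ⟨x, hx⟩
  refine ⟨⟨bijOn_entranceMeasure hA hirr hrec hfeller hjump, fun ν _ => ?_⟩, hexit, fun ν hν => ?_⟩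
  · simp [ProperEntrance, huniv]
  -- By surjectivity every invariant measure of the exit chain has a density P(x, A) with respect to
  -- some μ, so it ignores the points where P(x, A) = 0.
  · obtain ⟨μ, -, rfl⟩ := hexit.surjOn hν
    have hmeas := P.measurable_coe hA
    have hset : {x : (Aᶜ : Set X) | (x : X) ∉ exitSet P Aᶜ ∩ visitsBothSet P A} =
        Subtype.val ⁻¹' {x | P x A = 0} := by
      ext x
      have hx : (x : X) ∉ A := x.2
      simp [exitSet, huniv, hx]
    rw [ProperExit, hset, exitMeasure, (MeasurableEmbedding.subtype_coe hA.compl).comap_apply,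
      withDensity_apply_eq_zero hmeas]
    refine measure_mono_null (t := ∅) ?_ measure_empty
    rintro x ⟨hx, y, hy, rfl⟩
    exact hx hy
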